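/- Let $X$ be a real Banach space that is a predual of $\ell_1$, i.e. $X^*$ is identified with $\ell_1$ through a fixed linear isometry of $X^*$ onto $\ell_1$, and let $\sigma(\ell_1,X)$ be the corresponding weak* topology on $\ell_1$. For a class $\mathcal P$ of maps, $\ell_1$ has the $\sigma(\ell_1,X)$-fixed point property (FPP) for maps in $\mathcal P$ if for every nonempty convex $\sigma(\ell_1,X)$-compact set $C\subset\ell_1$, every map $T:C\to C$ in $\mathcal P$ has a fixed point; otherwise $\ell_1$ lacks it. A map $T:C\to C$ is nonexpansive if $\|Tx-Ty\|\le\|x-y\|$ for all $x,y\in C$, an isometry if $\|Tx-Ty\|=\|x-y\|$ for all $x,y\in C$, and contractive if $\|Tx-Ty\|<\|x-y\|$ for all $x,y\in C$ with $x\ne y$. Let $c$ be the space of convergent real sequences $x=(x(1),x(2),\dots)$ with the supremum norm. An element $f=(f(1),f(2),\dots)\in\ell_1$ acts on $c$ by $f(x)=f(1)\lim_{n}x(n)+\sum_{n=1}^\infty f(n+1)x(n)$, and $W_f=\{x\in c: f(x)=0\}$. The space $W_f$ is called bad if $\|f\|=1$, $|f(1)|=\tfrac12$ and the set $\{n\ge1: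 f(1)f(n+1)\le0\}$ is infinite. Then the following are equivalent. 1. $\ell_1$ lacks the $\sigma(\ell_1,X)$-FPP for nonexpansive maps. 2. $\ell_1$ lacks the $\sigma(\ell_1,X)$-FPP for isometries. 3. $\ell_1$ lacks the $\sigma(\ell_1,X)$-FPP for contractive maps. 4. There is a subsequence $(e^*_{n_k})_{k}$ of the standard basis $(e^*_n)_n$ of $\ell_1$ which is $\sigma(\ell_1,X)$-convergent to some $e^*\in\ell_1$ with $\|e^*\|=1$ and $e^*(n_k)\ge0$ for all $k$. 5. There are a closed subspace $Y$ of $X$ and a bad $W_f$ such that the quotient $X/Y$ is linearly isometric to $W_f$. 6. There are a closed subspace $Y$ of $X$ and a bad $W_g$ such that $X/Y$ contains a subspace linearly isometric to $W_g$. -/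

import Mathlib

open Filter Topology
open scoped ENNReal

noncomputable section

namespace WeakStarFPP

/-- The real Banach space `ℓ₁`; coordinates are indexed from `0`. -/
abbrev Ell1 : Type := lp (fun _ : ℕ => ℝ) 1

/-- The real Banach space `ℓ_∞` with the supremum norm. -/
abbrev EllInf : Type := lp (fun _ : ℕ => ℝ) ∞

/-- The space `c` of convergent real sequences, with the supremum norm inherited from `ℓ_∞`. -/
def spaceC : Submodule ℝ EllInf where
  carrier := {x | ∃ l : ℝ, Tendsto (fun n => x n) atTop (𝓝 l)}
  add_mem' := by
    rintro x y ⟨a, ha⟩ ⟨b, hb⟩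
    exact ⟨a + b, by simpa using ha.add hb⟩
  zero_mem' := ⟨0, by simp⟩
  smul_mem' := by
    rintro r x ⟨a, ha⟩
    exact ⟨r * a, by simpa using ha.const_mul r⟩

/-- The limit of a convergent sequence. -/
def limC (x : spaceC) : ℝ := x.2.choose

theorem tendsto_limC (x : spaceC) :
    Tendsto (fun n => (x : EllInf) n) atTop (𝓝 (limC x)) := x.2.choose_spec

theorem limC_add (x y : spaceC) : limC (x + y) = limC x + limC y :=
  tendsto_nhds_unique (tendsto_limC (x + y))
    (by simpa using (tendsto_limC x).add (tendsto_limC y))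

theorem limC_smul (r : ℝ) (x : spaceC) : limC (r • x) = r * limC x :=
  tendsto_nhds_unique (tendsto_limC (r • x))
    (by simpa using (tendsto_limC x).const_mul r)

theorem summable_pairing (f : Ell1) (x : spaceC) :
    Summable fun n : ℕ => f (n + 1) * (x : EllInf) n := by
  have hf : Summable fun n : ℕ => ‖f n‖ := by
    simpa using (lp.memℓp f).summable (by simp)
  refine Summable.of_norm_bounded
    (((summable_nat_add_iff 1).2 hf).mul_right ‖(x : EllInf)‖) fun n => ?_
  rw [norm_mul]
  exact mul_le_mul_of_nonneg_left
    (lp.norm_apply_le_norm ENNReal.top_ne_zero (x : EllInf) n) (norm_nonneg _)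

/-- The action of `f ∈ ℓ₁ = c*` on `c`: the coordinate of `f` with index `0` multiplies the limit
of the sequence, and the one with index `n + 1` multiplies its term with index `n`. -/
def pairing (f : Ell1) : spaceC →ₗ[ℝ] ℝ where
  toFun x := f 0 * limC x + ∑' n : ℕ, f (n + 1) * (x : EllInf) n
  map_add' x y := by
    have h := (summable_pairing f x).tsum_add (summable_pairing f y)
    have e : (∑' n : ℕ, f (n + 1) * ((x + y : spaceC) : EllInf) n) =
        ∑' n : ℕ, (f (n + 1) * (x : EllInf) n + f (n + 1) * (y : EllInf) n) :=
      tsum_congr fun n => by simp [mul_add]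
    rw [e, h, limC_add]
    ring
  map_smul' r x := by
    have e : (∑' n : ℕ, f (n + 1) * ((r • x : spaceC) : EllInf) n) =
        ∑' n : ℕ, r * (f (n + 1) * (x : EllInf) n) :=
      tsum_congr fun n => by simp [mul_left_comm]
    rw [e, tsum_mul_left, limC_smul]
    simp only [RingHom.id_apply, smul_eq_mul]
    ring

/-- The hyperplane `W_f = {x ∈ c : f(x) = 0}` of `c`, with the supremum norm. -/
def W (f : Ell1) : Submodule ℝ spaceC := LinearMap.ker (pairing f)

/-- `W_f` is "bad". -/
def IsBad (f : Ell1) : Prop :=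
  ‖f‖ = 1 ∧ |f 0| = 1 / 2 ∧ {n : ℕ | f 0 * f (n + 1) ≤ 0}.Infinite

variable {X : Type*} [NormedAddCommGroup X] [NormedSpace ℝ X]

/-- The topology `σ(ℓ₁, X)` on `ℓ₁`, where `ℓ₁` is identified with `X*` through `φ`. -/
abbrev weakStar (φ : StrongDual ℝ X ≃ₗᵢ[ℝ] Ell1) : TopologicalSpace Ell1 :=
  TopologicalSpace.induced (fun g => StrongDual.toWeakDual (φ.symm g))
    (inferInstance : TopologicalSpace (WeakDual ℝ X))

/-- `ℓ₁` has the `σ(ℓ₁, X)`-fixed point property for the self-maps of class `P`: every map of class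
`P` of a nonempty, convex, `σ(ℓ₁, X)`-compact set into itself has a fixed point. -/
def HasFPP (φ : StrongDual ℝ X ≃ₗᵢ[ℝ] Ell1) (P : ∀ C : Set Ell1, (C → C) → Prop) : Prop :=
  ∀ C : Set Ell1, C.Nonempty → Convex ℝ C → @IsCompact Ell1 (weakStar φ) C →
    ∀ T : C → C, P C T → ∃ x : C, T x = x

/-- `‖T x - T y‖ ≤ ‖x - y‖` for all `x`, `y`. -/
def Nonexpansive (C : Set Ell1) (T : C → C) : Prop :=
  ∀ x y : C, ‖(T x : Ell1) - T y‖ ≤ ‖(x : Ell1) - y‖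

/-- `‖T x - T y‖ = ‖x - y‖` for all `x`, `y` (surjectivity is not required). -/
def Isometric (C : Set Ell1) (T : C → C) : Prop :=
  ∀ x y : C, ‖(T x : Ell1) - T y‖ = ‖(x : Ell1) - y‖

/-- `‖T x - T y‖ < ‖x - y‖` for all `x ≠ y`. -/
def Contractive (C : Set Ell1) (T : C → C) : Prop :=
  ∀ x y : C, x ≠ y → ‖(T x : Ell1) - T y‖ < ‖(x : Ell1) - y‖

/-- The standard basis of `ℓ₁`. -/
def stdBasis (n : ℕ) : Ell1 := lp.single 1 n (1 : ℝ)

end WeakStarFPP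

end

/-!
If a nonexpansive map has no fixed point, take a minimal invariant weak* compact convex set `K` and
a coordinatewise limit `y` of approximate fixed points `x m ∈ K`. Since `‖u - v‖ ≈ ‖u‖ + ‖v‖` when
the coordinates of `u` are small, `T` does not increase the distance to `y`, which is therefore
constant on `K`. Separating the weak* compact set `K - y` from smaller balls gives elements of `X`
which asymptotically norm the normalized differences `x m - y`. As these tend to zero coordinatewise
they can be replaced by signed basis vectors, and a weak* cluster point of those is the limit in
(4).

Conversely, if `e` is the limit in (4), the part of `e` outside a tail of the subsequence and the
basis vectors of that tail have disjoint supports. They span an isometric copy of `ℓ₁` in `X*` whose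
basis converges weak* to a point of its simplex, so this simplex is weak* compact. The right shift
is an isometry of it without fixed points, and an average of the powers of the shift is contractive
without fixed points. The basis of the copy also gives an operator from `X` to a bad hyperplane of
`c` whose adjoint is isometric, hence a quotient map onto this hyperplane.

A bad hyperplane inside a quotient of `X` leads back to (4): by Hahn–Banach its coordinate
functionals come from elements `x m` of the unit ball of `ℓ₁`. Truncations of suitable sequences to
the hyperplane show that the `x m` are pairwise disjoint and that, along the indices `n` with
`f(1) f(n+1) ≤ 0`, they are asymptotically normed by elements of `X`.
-/

noncomputable section

namespace WeakStarFPP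

variable {X : Type*} [NormedAddCommGroup X] [NormedSpace ℝ X]

/-! ### Coordinates of elements of `ℓ₁` -/

section Coordinates

theorem hasSum_abs (f : Ell1) : HasSum (fun i => |f i|) ‖f‖ := by
  simpa using lp.hasSum_norm (by simp) f

theorem summable_abs (f : Ell1) : Summable fun i => |f i| := (hasSum_abs f).summable

theorem summable_apply (f : Ell1) : Summable fun i => f i := (summable_abs f).of_abs

/-- The element of `ℓ₁` with the given absolutely summable coordinates. -/
def ofSummable (a : ℕ → ℝ) (ha : Summable fun i => |a i|) : Ell1 :=
  ⟨a, memℓp_gen (by simpa using ha)⟩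

theorem norm_stdBasis (n : ℕ) : ‖stdBasis n‖ = 1 := by
  simp [stdBasis, lp.norm_single]

theorem stdBasis_apply_self (n : ℕ) : stdBasis n n = 1 := by
  simp [stdBasis]

theorem stdBasis_apply_of_ne {i n : ℕ} (h : i ≠ n) : stdBasis n i = 0 := by
  simp [stdBasis, h]

theorem hasSum_smul_stdBasis (f : Ell1) : HasSum (fun i => f i • stdBasis i) f := by
  refine (lp.hasSum_single (p := 1) (by simp) f).congr_fun fun i => ?_
  rw [stdBasis, ← lp.single_smul, smul_eq_mul, mul_one]

theorem hasSum_mul_apply_stdBasis (A : Ell1 →ₗᵢ[ℝ] StrongDual ℝ X) (f : Ell1) (z : X) :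
    HasSum (fun i => f i * A (stdBasis i) z) (A f z) := by
  have h := (hasSum_smul_stdBasis f).mapL
    ((ContinuousLinearMap.apply ℝ ℝ z).comp A.toContinuousLinearMap)
  simpa using h

theorem mul_apply_nonneg_of_norm_add {x y : Ell1} (h : ‖x‖ + ‖y‖ ≤ ‖x + y‖) (i : ℕ) :
    0 ≤ x i * y i := by
  have hsum : HasSum (fun i => |x i| + |y i| - |x i + y i|) (‖x‖ + ‖y‖ - ‖x + y‖) :=
    ((hasSum_abs x).add (hasSum_abs y)).sub (hasSum_abs (x + y))
  have hi : |x i| + |y i| - |x i + y i| ≤ 0 :=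
    (le_hasSum hsum i fun j _ => sub_nonneg.2 (abs_add_le _ _)).trans (sub_nonpos.2 h)
  rcases abs_add_eq_add_abs_iff (x i) (y i) |>.1
    (le_antisymm (abs_add_le _ _) (sub_nonpos.1 hi)) with ⟨hx, hy⟩ | ⟨hx, hy⟩
  · exact mul_nonneg hx hy
  · exact mul_nonneg_of_nonpos_of_nonpos hx hy

theorem apply_eq_zero_or_of_norm_add_of_norm_sub {x y : Ell1} (hadd : ‖x‖ + ‖y‖ ≤ ‖x + y‖)
    (hsub : ‖x‖ + ‖y‖ ≤ ‖x - y‖) (i : ℕ) : x i = 0 ∨ y i = 0 := by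
  have hneg : 0 ≤ x i * (-y) i :=
    mul_apply_nonneg_of_norm_add (by rwa [norm_neg, ← sub_eq_add_neg]) i
  have hpos := mul_apply_nonneg_of_norm_add hadd i
  rw [lp.coeFn_neg, Pi.neg_apply, mul_neg] at hneg
  exact mul_eq_zero.1 (le_antisymm (neg_nonneg.1 hneg) hpos)

end Coordinates

/-! ### Separability of preduals -/

section Separability

variable {E : Type*} [NormedAddCommGroup E] [NormedSpace ℝ E]

theorem separableSpace_of_span_range_dense {x : ℕ → E}
    (hx : (Submodule.span ℝ (Set.range x)).topologicalClosure = ⊤) :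
    TopologicalSpace.SeparableSpace E := by
  have hsep := ((Set.countable_range x).isSeparable.span (R := ℝ)).closure
  rw [← Submodule.topologicalClosure_coe, hx] at hsep
  exact TopologicalSpace.isSeparable_univ_iff.1 hsep

theorem separableSpace_ell1 : TopologicalSpace.SeparableSpace Ell1 := by
  refine separableSpace_of_span_range_dense (x := stdBasis) (eq_top_iff.2 fun f _ => ?_)
  refine mem_closure_of_tendsto (hasSum_smul_stdBasis f) (Eventually.of_forall fun s => ?_)
  exact Submodule.sum_mem _ fun i _ => Submodule.smul_mem _ _ (Submodule.subset_span ⟨i, rfl⟩)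

theorem exists_norm_le_one_norm_half_le (f : StrongDual ℝ E) :
    ∃ x : E, ‖x‖ ≤ 1 ∧ ‖f‖ / 2 ≤ ‖f x‖ := by
  rcases eq_or_ne f 0 with rfl | hf
  · exact ⟨0, by simp, by simp⟩
  · obtain ⟨x, hx, hfx⟩ := f.exists_lt_apply_of_lt_opNorm (half_lt_self (norm_pos_iff.2 hf))
    exact ⟨x, hx.le, hfx.le⟩

theorem exists_dual_vanishing_ne_zero {p : Submodule ℝ E} (hp : IsClosed (p : Set E)) {v : E}
    (hv : v ∉ p) : ∃ g : StrongDual ℝ E, g v ≠ 0 ∧ ∀ w ∈ p, g w = 0 := by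
  obtain ⟨g, hg⟩ := SeparatingDual.exists_ne_zero (R := ℝ)
    (mt (Submodule.Quotient.mk_eq_zero p).1 hv)
  refine ⟨g.comp p.mkQL, hg, fun w hw => ?_⟩
  have hw0 : p.mkQL w = 0 := (Submodule.Quotient.mk_eq_zero p).2 hw
  rw [ContinuousLinearMap.comp_apply, hw0, map_zero]

theorem span_range_dense_of_norming {f : ℕ → StrongDual ℝ E} (hf : DenseRange f) {x : ℕ → E}
    (hx : ∀ n, ‖x n‖ ≤ 1) (hfx : ∀ n, ‖f n‖ / 2 ≤ ‖f n (x n)‖) :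
    (Submodule.span ℝ (Set.range x)).topologicalClosure = ⊤ := by
  rw [eq_top_iff]
  intro v _
  by_contra hv
  obtain ⟨g, hgv, hg⟩ := exists_dual_vanishing_ne_zero (Submodule.isClosed_topologicalClosure _) hv
  have hg0 : 0 < ‖g‖ := norm_pos_iff.2 fun h => hgv (by rw [h]; rfl)
  obtain ⟨n, hn⟩ := hf.exists_dist_lt g (show 0 < ‖g‖ / 4 by positivity)
  rw [dist_eq_norm] at hn
  have hgx : g (x n) = 0 :=
    hg _ (Submodule.le_topologicalClosure _ (Submodule.subset_span ⟨n, rfl⟩))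
  have hfn : ‖f n‖ / 2 ≤ ‖g - f n‖ :=
    calc ‖f n‖ / 2 ≤ ‖f n (x n)‖ := hfx n
      _ = ‖(g - f n) (x n)‖ := by simp [hgx]
      _ ≤ ‖g - f n‖ := (g - f n).unit_le_opNorm _ (hx n)
  have hgf : ‖g‖ ≤ ‖g - f n‖ + ‖f n‖ := by simpa using norm_add_le (g - f n) (f n)
  linarith

theorem separableSpace_of_dual [TopologicalSpace.SeparableSpace (StrongDual ℝ E)] :
    TopologicalSpace.SeparableSpace E := by
  choose x hx hfx using fun n =>
    exists_norm_le_one_norm_half_le (TopologicalSpace.denseSeq (StrongDual ℝ E) n)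
  exact separableSpace_of_span_range_dense
    (span_range_dense_of_norming (TopologicalSpace.denseRange_denseSeq _) hx hfx)

end Separability

/-! ### The duality between `ℓ₁` and `X` -/

section Duality

variable (φ : StrongDual ℝ X ≃ₗᵢ[ℝ] Ell1)

theorem hasSum_dual_apply (x : Ell1) (z : X) :
    HasSum (fun i => x i * φ.symm (stdBasis i) z) (φ.symm x z) :=
  hasSum_mul_apply_stdBasis φ.symm.toLinearIsometry x z

theorem abs_dual_apply_le (x : Ell1) (z : X) : |φ.symm x z| ≤ ‖x‖ * ‖z‖ := by
  simpa using (φ.symm x).le_opNorm z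

theorem dual_apply_le_norm (x : Ell1) {z : X} (hz : ‖z‖ ≤ 1) : φ.symm x z ≤ ‖x‖ :=
  (le_abs_self _).trans <| (abs_dual_apply_le φ x z).trans <|
    mul_le_of_le_one_right (norm_nonneg x) hz

/-- `ℓ₁` as a set of functionals on `X`, with the weak* topology. -/
def toWeak : Ell1 ≃ₗ[ℝ] WeakDual ℝ X :=
  φ.symm.toLinearEquiv.trans StrongDual.toWeakDual

theorem isCompact_weakStar_iff {C : Set Ell1} :
    @IsCompact Ell1 (weakStar φ) C ↔ IsCompact (toWeak φ '' C) :=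
  letI := weakStar φ
  (IsInducing.mk rfl : IsInducing (toWeak φ)).isCompact_iff

theorem tendsto_weakStar_iff {ι : Type*} {l : Filter ι} {g : ι → Ell1} {e : Ell1} :
    Tendsto g l (@nhds Ell1 (weakStar φ) e) ↔
      ∀ z : X, Tendsto (fun k => φ.symm (g k) z) l (𝓝 (φ.symm e z)) := by
  have h : @nhds Ell1 (weakStar φ) e = comap (toWeak φ) (𝓝 (toWeak φ e)) := nhds_induced _ _
  rw [h, tendsto_comap_iff, tendsto_iff_forall_eval_tendsto_topDualPairing]
  rfl

theorem exists_subseq_tendsto_weakStar {g : ℕ → Ell1} (hg : ∀ n, ‖g n‖ ≤ 1) :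
    ∃ (e : Ell1) (s : ℕ → ℕ), StrictMono s ∧ ∀ z : X,
      Tendsto (fun k => φ.symm (g (s k)) z) atTop (𝓝 (φ.symm e z)) := by
  have := separableSpace_ell1
  have : TopologicalSpace.SeparableSpace (StrongDual ℝ X) :=
    φ.symm.surjective.denseRange.separableSpace φ.symm.continuous
  have : TopologicalSpace.SeparableSpace X := separableSpace_of_dual
  obtain ⟨a, -, s, hs, ha⟩ := WeakDual.isSeqCompact_closedBall ℝ X 0 1
    (x := fun n => toWeak φ (g n)) (fun n => by simpa [toWeak] using hg n)
  rw [← (toWeak φ).apply_symm_apply a] at ha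
  exact ⟨(toWeak φ).symm a, s, hs, tendsto_iff_forall_eval_tendsto_topDualPairing.1 ha⟩

theorem norm_le_one_of_tendsto {ι : Type*} {l : Filter ι} [l.NeBot] {g : ι → Ell1} {e : Ell1}
    (hg : ∀ k, ‖g k‖ ≤ 1)
    (h : ∀ z : X, Tendsto (fun k => φ.symm (g k) z) l (𝓝 (φ.symm e z))) : ‖e‖ ≤ 1 := by
  rw [← φ.symm.norm_map]
  refine ContinuousLinearMap.opNorm_le_bound _ zero_le_one fun z => ?_
  refine le_of_tendsto (h z).norm (Eventually.of_forall fun k => ?_)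
  exact (abs_dual_apply_le φ (g k) z).trans
    (mul_le_mul_of_nonneg_right (hg k) (norm_nonneg z))

end Duality

/-! ### Subsequences of the standard basis from norming sequences -/

section Norming

variable (φ : StrongDual ℝ X ≃ₗᵢ[ℝ] Ell1)

/-- The condition on `φ` that characterizes failure of the fixed point property: a subsequence of
the standard basis converges weak* to an element of norm one whose coordinates along this
subsequence are nonnegative. -/
def HasNormOneLimit : Prop :=
  ∃ n : ℕ → ℕ, StrictMono n ∧ ∃ e : Ell1, ‖e‖ = 1 ∧
    Tendsto (fun k => stdBasis (n k)) atTop (@nhds Ell1 (weakStar φ) e) ∧ ∀ k, 0 ≤ e (n k)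

/-- The elements `x m` of the unit ball of `ℓ₁` are asymptotically normed by the elements `z j` of
the unit ball of `X`: the values `⟨x m, z j⟩` tend to `1` as `j → ∞` for each fixed `m`, and their
lower limits as `m → ∞` for fixed `j` are bounded below by a sequence tending to `1`. -/
structure IsAsymptoticallyNormed (x : ℕ → Ell1) (z : ℕ → X) : Prop where
  norm_le_one : ∀ m, ‖x m‖ ≤ 1
  norming_norm_le_one : ∀ j, ‖z j‖ ≤ 1
  tendsto_one : ∀ m, Tendsto (fun j => φ.symm (x m) (z j)) atTop (𝓝 1)
  exists_lower_bound : ∃ a : ℕ → ℝ, Tendsto a atTop (𝓝 1) ∧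
    ∀ j, ∀ᶠ m in atTop, a j ≤ φ.symm (x m) (z j)

theorem le_norm_of_tendsto_dual {x : Ell1} {z : ℕ → X} {r : ℝ} (hz : ∀ j, ‖z j‖ ≤ 1)
    (h : Tendsto (fun j => φ.symm x (z j)) atTop (𝓝 r)) : r ≤ ‖x‖ :=
  le_of_tendsto h (Eventually.of_forall fun j => dual_apply_le_norm φ x (hz j))

theorem sign_mul_stdBasis_le_one (σ : SignType) (i : ℕ) {z : X} (hz : ‖z‖ ≤ 1) :
    σ * φ.symm (stdBasis i) z ≤ 1 := by
  have h : |φ.symm (stdBasis i) z| ≤ 1 :=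
    (abs_dual_apply_le φ _ z).trans (by rwa [norm_stdBasis, one_mul])
  rcases abs_le.1 h with ⟨hl, hu⟩
  cases σ <;> simp only [SignType.coe_zero, SignType.coe_one, SignType.coe_neg_one,
    SignType.zero_eq_zero, SignType.pos_eq_one, SignType.neg_eq_neg_one] <;> linarith

/-- The amount `‖x‖ - ⟨x, z⟩` by which `z` fails to norm `x`, split into the contributions of the
coordinates. -/
def normingDefect (x : Ell1) (z : X) (i : ℕ) : ℝ :=
  |x i| * (1 - SignType.sign (x i) * φ.symm (stdBasis i) z)

theorem hasSum_normingDefect (x : Ell1) (z : X) :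
    HasSum (normingDefect φ x z) (‖x‖ - φ.symm x z) := by
  refine ((hasSum_abs x).sub (hasSum_dual_apply φ x z)).congr_fun fun i => ?_
  rw [normingDefect, mul_sub, mul_one, ← mul_assoc, mul_comm |x i|, sign_mul_abs]

theorem normingDefect_nonneg (x : Ell1) {z : X} (hz : ‖z‖ ≤ 1) (i : ℕ) :
    0 ≤ normingDefect φ x z i :=
  mul_nonneg (abs_nonneg _) (sub_nonneg.2 (sign_mul_stdBasis_le_one φ _ i hz))

theorem tendsto_sign_mul_stdBasis {x : Ell1} {z : ℕ → X} (hx : ‖x‖ ≤ 1) (hz : ∀ j, ‖z j‖ ≤ 1)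
    (hxz : Tendsto (fun j => φ.symm x (z j)) atTop (𝓝 1)) {i : ℕ} (hi : x i ≠ 0) :
    Tendsto (fun j => SignType.sign (x i) * φ.symm (stdBasis i) (z j)) atTop (𝓝 1) := by
  have hdefect : Tendsto (fun j => normingDefect φ x (z j) i) atTop (𝓝 0) := by
    refine squeeze_zero (fun j => normingDefect_nonneg φ x (hz j) i) (fun j => ?_)
      (by simpa using hxz.const_sub 1)
    exact (le_hasSum (hasSum_normingDefect φ x (z j)) i
      fun k _ => normingDefect_nonneg φ x (hz j) k).trans (sub_le_sub_right hx _)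
  simpa [normingDefect, mul_div_cancel_left₀ _ (abs_ne_zero.2 hi)]
    using (hdefect.div_const |x i|).const_sub 1

theorem exists_lt_abs_apply_of_hasSum {x : Ell1} {g : ℕ → ℝ} {G : ℝ} (hg : ∀ i, 0 ≤ g i)
    (hG : HasSum g G) {N : ℕ} (h : G + ∑ i ∈ Finset.range N, |x i| < ‖x‖) :
    ∃ i, N ≤ i ∧ g i < |x i| := by
  by_contra! hle
  have htail : ‖x‖ - ∑ i ∈ Finset.range N, |x i| ≤ G - ∑ i ∈ Finset.range N, g i :=
    hasSum_le (fun i => hle (i + N) (Nat.le_add_left N i))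
      ((hasSum_nat_add_iff' N).2 (hasSum_abs x)) ((hasSum_nat_add_iff' N).2 hG)
  linarith [Finset.sum_nonneg fun i (_ : i ∈ Finset.range N) => hg i]

theorem sum_two_pow_mul_le {k : ℕ} {d : ℕ → ℝ} (hd : ∀ j ≤ k, d j ≤ (1 / 4) ^ (j + 2)) :
    ∑ j ∈ Finset.range (k + 1), 2 ^ j * d j ≤ 1 / 8 :=
  calc ∑ j ∈ Finset.range (k + 1), 2 ^ j * d j
      ≤ ∑ j ∈ Finset.range (k + 1), 1 / 16 * (1 / 2 : ℝ) ^ j := by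
        refine Finset.sum_le_sum fun j hj => ?_
        calc (2 : ℝ) ^ j * d j ≤ 2 ^ j * (1 / 4) ^ (j + 2) :=
              mul_le_mul_of_nonneg_left (hd j (Finset.mem_range_succ_iff.1 hj)) (by positivity)
          _ = 1 / 16 * (1 / 2 : ℝ) ^ j := by
              rw [pow_add, ← mul_assoc, ← mul_pow]; norm_num [mul_comm]
    _ ≤ 1 / 8 := by
        rw [← Finset.mul_sum]
        linarith [sum_geometric_two_le (k + 1)]

theorem exists_stdBasis_almost_normed {x : Ell1} {z : ℕ → X} (hz : ∀ j, ‖z j‖ ≤ 1) {k N : ℕ}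
    (hx : ‖x‖ ≤ 1) (hxz : ∀ j ≤ k, 1 - (1 / 4) ^ (j + 2) ≤ φ.symm x (z j))
    (hN : ∑ i ∈ Finset.range N, |x i| ≤ 1 / 4) :
    ∃ i, N ≤ i ∧ x i ≠ 0 ∧
      ∀ j ≤ k, 1 - (1 / 2) ^ j ≤ SignType.sign (x i) * φ.symm (stdBasis i) (z j) := by
  set g : ℕ → ℝ := fun i => ∑ j ∈ Finset.range (k + 1), 2 ^ j * normingDefect φ x (z j) i
  have hterm : ∀ i j, 0 ≤ 2 ^ j * normingDefect φ x (z j) i := fun i j =>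
    mul_nonneg (by positivity) (normingDefect_nonneg φ x (hz j) i)
  have hg : ∀ i, 0 ≤ g i := fun i => Finset.sum_nonneg fun j _ => hterm i j
  have hG : HasSum g (∑ j ∈ Finset.range (k + 1), 2 ^ j * (‖x‖ - φ.symm x (z j))) :=
    hasSum_sum fun j _ => (hasSum_normingDefect φ x (z j)).mul_left _
  have hG8 : ∑ j ∈ Finset.range (k + 1), 2 ^ j * (‖x‖ - φ.symm x (z j)) ≤ 1 / 8 :=
    sum_two_pow_mul_le fun j hj => by linarith [hxz j hj]
  have hnorm : 15 / 16 ≤ ‖x‖ :=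
    (by norm_num : (15 / 16 : ℝ) = 1 - (1 / 4) ^ (0 + 2)).trans_le <|
      (hxz 0 k.zero_le).trans (dual_apply_le_norm φ x (hz 0))
  obtain ⟨i, hNi, hi⟩ := exists_lt_abs_apply_of_hasSum hg hG (by linarith : _ < ‖x‖)
  have hpos : 0 < |x i| := (hg i).trans_lt hi
  refine ⟨i, hNi, abs_pos.1 hpos, fun j hj => ?_⟩
  have hj : 2 ^ j * normingDefect φ x (z j) i < |x i| :=
    (Finset.single_le_sum (fun j _ => hterm i j) (Finset.mem_range_succ_iff.2 hj)).trans_lt hi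
  rw [normingDefect, mul_left_comm, mul_lt_iff_lt_one_right hpos, mul_comm,
    ← lt_div_iff₀ (by positivity), ← one_div_pow] at hj
  linarith

variable {φ}

theorem IsAsymptoticallyNormed.comp {x : ℕ → Ell1} {z : ℕ → X}
    (h : IsAsymptoticallyNormed φ x z) {r : ℕ → ℕ} (hr : StrictMono r) :
    IsAsymptoticallyNormed φ x (z ∘ r) where
  norm_le_one := h.norm_le_one
  norming_norm_le_one j := h.norming_norm_le_one (r j)
  tendsto_one m := (h.tendsto_one m).comp hr.tendsto_atTop
  exists_lower_bound :=
    let ⟨a, ha, hax⟩ := h.exists_lower_bound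
    ⟨a ∘ r, ha.comp hr.tendsto_atTop, fun j => hax (r j)⟩

theorem IsAsymptoticallyNormed.exists_subseq_rapid {x : ℕ → Ell1} {z : ℕ → X}
    (h : IsAsymptoticallyNormed φ x z) :
    ∃ r : ℕ → ℕ, StrictMono r ∧
      ∀ j, ∀ᶠ m in atTop, 1 - (1 / 4) ^ (j + 2) ≤ φ.symm (x m) (z (r j)) := by
  obtain ⟨a, ha, hax⟩ := h.exists_lower_bound
  obtain ⟨r, hr, har⟩ := extraction_forall_of_eventually
    (P := fun j i => 1 - (1 / 4) ^ (j + 2) < a i) fun j =>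
      ha.eventually (lt_mem_nhds (sub_lt_self 1 (by positivity)))
  exact ⟨r, hr, fun j => (hax (r j)).mono fun m hm => (har j).le.trans hm⟩

theorem IsAsymptoticallyNormed.frequently_stdBasis {x : ℕ → Ell1} {z : ℕ → X}
    (h : IsAsymptoticallyNormed φ x z) (hx0 : ∀ i, Tendsto (fun m => x m i) atTop (𝓝 0))
    (hrapid : ∀ j, ∀ᶠ m in atTop, 1 - (1 / 4) ^ (j + 2) ≤ φ.symm (x m) (z j)) (k : ℕ) :
    ∃ᶠ i in atTop, ∃ σ : SignType, σ ≠ 0 ∧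
      (∀ j ≤ k, 1 - (1 / 2) ^ j ≤ σ * φ.symm (stdBasis i) (z j)) ∧
      Tendsto (fun j => σ * φ.symm (stdBasis i) (z j)) atTop (𝓝 1) := by
  rw [frequently_atTop]
  intro N
  have hnormed : ∀ᶠ m in atTop, ∀ j ≤ k, 1 - (1 / 4) ^ (j + 2) ≤ φ.symm (x m) (z j) :=
    (Set.finite_Iic k).eventually_all.2 fun j _ => hrapid j
  have hhead : Tendsto (fun m => ∑ i ∈ Finset.range N, |x m i|) atTop (𝓝 0) := by
    simpa using tendsto_finsetSum (Finset.range N) fun i _ => (hx0 i).abs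
  obtain ⟨m, hm, hmN⟩ :=
    (hnormed.and (hhead.eventually (ge_mem_nhds (by norm_num : (0 : ℝ) < 1 / 4)))).exists
  obtain ⟨i, hNi, hi, hik⟩ := exists_stdBasis_almost_normed φ h.norming_norm_le_one
    (h.norm_le_one m) hm hmN
  exact ⟨i, hNi, SignType.sign (x m i), sign_ne_zero.2 hi, hik, tendsto_sign_mul_stdBasis φ
    (h.norm_le_one m) h.norming_norm_le_one (h.tendsto_one m) hi⟩

theorem IsAsymptoticallyNormed.exists_signed_stdBasis {x : ℕ → Ell1} {z : ℕ → X}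
    (h : IsAsymptoticallyNormed φ x z) (hx0 : ∀ i, Tendsto (fun m => x m i) atTop (𝓝 0)) :
    ∃ (τ : ℝ) (n r : ℕ → ℕ), |τ| = 1 ∧ StrictMono n ∧
      IsAsymptoticallyNormed φ (fun k => τ • stdBasis (n k)) (z ∘ r) := by
  obtain ⟨r, hr, hrapid⟩ := h.exists_subseq_rapid
  obtain ⟨n, hn, hP⟩ :=
    extraction_forall_of_frequently ((h.comp hr).frequently_stdBasis hx0 hrapid)
  choose σ hσ0 hσ hσ1 using hP
  obtain ⟨τ, hτ⟩ : ∃ τ, ∃ᶠ k in atTop, σ k = τ := by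
    by_contra! hne
    obtain ⟨k, hk⟩ := (eventually_all.2 hne).exists
    exact hk (σ k) rfl
  obtain ⟨t, ht, htτ⟩ := extraction_of_frequently_atTop hτ
  have habs : |(τ : ℝ)| = 1 := by
    have hτ0 : τ ≠ 0 := htτ 0 ▸ hσ0 (t 0)
    cases τ <;> simp_all
  refine ⟨τ, n ∘ t, r, habs, hn.comp ht, ⟨fun k => ?_, fun j => h.norming_norm_le_one _,
    fun k => ?_, fun j => 1 - (1 / 2) ^ j, ?_, fun j => ?_⟩⟩
  · rw [norm_smul, Real.norm_eq_abs, habs, norm_stdBasis, one_mul]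
  · simpa [htτ] using hσ1 (t k)
  · simpa using (tendsto_pow_atTop_nhds_zero_of_lt_one (r := (1 / 2 : ℝ))
      (by norm_num) (by norm_num)).const_sub 1
  · filter_upwards [eventually_ge_atTop j] with k hk
    simpa [htτ] using hσ (t k) j (hk.trans (ht.id_le k))

theorem IsAsymptoticallyNormed.hasNormOneLimit_of_stdBasis {τ : ℝ} (hτ : |τ| = 1) {n : ℕ → ℕ}
    (hn : StrictMono n) {z : ℕ → X}
    (h : IsAsymptoticallyNormed φ (fun k => τ • stdBasis (n k)) z) : HasNormOneLimit φ := by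
  obtain ⟨e, s, hs, hse⟩ := exists_subseq_tendsto_weakStar φ (g := fun k => stdBasis (n k))
    fun k => (norm_stdBasis _).le
  have he : ‖e‖ ≤ 1 := norm_le_one_of_tendsto φ (fun k => (norm_stdBasis _).le) hse
  have hτe : ‖τ • e‖ = ‖e‖ := by rw [norm_smul, Real.norm_eq_abs, hτ, one_mul]
  obtain ⟨a, ha, hax⟩ := h.exists_lower_bound
  have hlower : ∀ j, a j ≤ φ.symm (τ • e) (z j) := fun j => by
    have hlim : Tendsto (fun k => φ.symm (τ • stdBasis (n (s k))) (z j)) atTop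
        (𝓝 (φ.symm (τ • e) (z j))) := by
      simpa using (hse (z j)).const_mul τ
    exact ge_of_tendsto hlim (hs.tendsto_atTop.eventually (hax j))
  have hnormed : Tendsto (fun j => φ.symm (τ • e) (z j)) atTop (𝓝 1) :=
    tendsto_of_tendsto_of_tendsto_of_le_of_le ha tendsto_const_nhds hlower fun j =>
      (dual_apply_le_norm φ _ (h.norming_norm_le_one j)).trans (hτe.trans_le he)
  refine ⟨n ∘ s, hn.comp hs, e, le_antisymm he ?_, (tendsto_weakStar_iff φ).2 hse, fun k => ?_⟩
  · exact hτe ▸ le_norm_of_tendsto_dual φ h.norming_norm_le_one hnormed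
  · have hsum : ‖τ • e‖ + ‖τ • stdBasis (n (s k))‖ ≤ ‖τ • e + τ • stdBasis (n (s k))‖ := by
      refine (add_le_add (hτe.trans_le he) (h.norm_le_one (s k))).trans ?_
      refine le_norm_of_tendsto_dual φ h.norming_norm_le_one ?_
      simpa using hnormed.add (h.tendsto_one (s k))
    have hmul := mul_apply_nonneg_of_norm_add hsum (n (s k))
    have hττ : τ * τ = 1 := by rw [← abs_mul_abs_self, hτ, one_mul]
    simpa [stdBasis_apply_self, mul_right_comm τ, hττ] using hmul

theorem IsAsymptoticallyNormed.hasNormOneLimit {x : ℕ → Ell1} {z : ℕ → X}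
    (h : IsAsymptoticallyNormed φ x z) (hx0 : ∀ i, Tendsto (fun m => x m i) atTop (𝓝 0)) :
    HasNormOneLimit φ := by
  obtain ⟨τ, n, r, hτ, hn, hτn⟩ := h.exists_signed_stdBasis hx0
  exact hτn.hasNormOneLimit_of_stdBasis hτ hn

end Norming

/-! ### Nonexpansive maps without fixed points -/

/-- Nonempty compact convex sets mapped into themselves by `T`. -/
structure IsInvariantConvexCompact {E : Type*} [AddCommMonoid E] [Module ℝ E]
    (t : TopologicalSpace E) (T : E → E) (K : Set E) : Prop where
  nonempty : K.Nonempty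
  convex : Convex ℝ K
  isCompact : IsCompact K
  mapsTo : Set.MapsTo T K K

theorem IsInvariantConvexCompact.exists_minimal {E : Type*} [AddCommMonoid E] [Module ℝ E]
    {t : TopologicalSpace E} [T2Space E] {T : E → E} {C : Set E}
    (hC : IsInvariantConvexCompact t T C) :
    ∃ K ⊆ C, Minimal (IsInvariantConvexCompact t T) K := by
  refine zorn_superset_nonempty {K | IsInvariantConvexCompact t T K}
    (fun c hc hchain hne => ?_) C hC
  have := hne.to_subtype
  obtain ⟨s, hs⟩ := hne
  have hclosed : ∀ s ∈ c, IsClosed s := fun s hs => (hc hs).isCompact.isClosed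
  refine ⟨⋂₀ c, ⟨?_, convex_sInter fun s hs => (hc hs).convex,
    (hc hs).isCompact.of_isClosed_subset (isClosed_sInter hclosed) (Set.sInter_subset_of_mem hs),
    fun x hx s hs => (hc hs).mapsTo (hx s hs)⟩, fun s hs => Set.sInter_subset_of_mem hs⟩
  exact IsCompact.nonempty_sInter_of_directed_nonempty_isCompact_isClosed
    (fun s hs t ht => (hchain.total hs ht).elim (fun h => ⟨s, hs, subset_rfl, h⟩)
      fun h => ⟨t, ht, h, subset_rfl⟩)
    (fun s hs => (hc hs).nonempty) (fun s hs => (hc hs).isCompact) hclosed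

/-- Banach's theorem applied to the contractions `x ↦ δ p + (1 - δ) T x`. -/
theorem exists_map_sub_eq_smul {E : Type*} [NormedAddCommGroup E] [NormedSpace ℝ E] {K : Set E}
    (hK : IsComplete K) (hconv : Convex ℝ K) {T : E → E} (hT : Set.MapsTo T K K)
    (hTn : ∀ x ∈ K, ∀ y ∈ K, ‖T x - T y‖ ≤ ‖x - y‖) {p : E} (hp : p ∈ K) {δ : ℝ} (hδ : 0 < δ)
    (hδ1 : δ ≤ 1) : ∃ x ∈ K, T x - x = δ • (T x - p) := by
  let S : E → E := fun x => δ • p + (1 - δ) • T x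
  have hδ' : 0 ≤ 1 - δ := sub_nonneg.2 hδ1
  have hS : Set.MapsTo S K K := fun x hx => hconv hp (hT hx) hδ.le hδ' (add_sub_cancel _ _)
  have hcontr : ContractingWith (Real.toNNReal (1 - δ)) (hS.restrict S K K) := by
    refine ⟨Real.toNNReal_lt_one.2 (sub_lt_self 1 hδ), LipschitzWith.of_dist_le_mul fun x y => ?_⟩
    rw [Real.coe_toNNReal _ hδ', Subtype.dist_eq, Subtype.dist_eq]
    simp only [Set.MapsTo.val_restrict_apply, dist_eq_norm, S]
    rw [add_sub_add_left_eq_sub, ← smul_sub, norm_smul, Real.norm_of_nonneg hδ']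
    exact mul_le_mul_of_nonneg_left (hTn _ x.2 _ y.2) hδ'
  obtain ⟨x, hx, hfix, -⟩ := hcontr.exists_fixedPoint' hK hS hp (edist_ne_top _ _)
  have hfix : δ • p + (1 - δ) • T x = x := hfix
  refine ⟨x, hx, ?_⟩
  nth_rewrite 2 [← hfix]
  module

theorem exists_approx_fixedPoint_seq {E : Type*} [NormedAddCommGroup E] [NormedSpace ℝ E]
    {K : Set E} (hK : IsComplete K) (hne : K.Nonempty) (hconv : Convex ℝ K)
    (hb : Bornology.IsBounded K) {T : E → E} (hT : Set.MapsTo T K K)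
    (hTn : ∀ x ∈ K, ∀ y ∈ K, ‖T x - T y‖ ≤ ‖x - y‖) :
    ∃ x : ℕ → E, (∀ n, x n ∈ K) ∧ Tendsto (fun n => ‖T (x n) - x n‖) atTop (𝓝 0) := by
  obtain ⟨p, hp⟩ := hne
  obtain ⟨R, hR⟩ := hb.exists_norm_le
  choose x hxK hx using fun n : ℕ => exists_map_sub_eq_smul hK hconv hT hTn hp
    (Nat.one_div_pos_of_nat (n := n)) (Nat.one_div_le_one_div (Nat.zero_le n) |>.trans (by simp))
  refine ⟨x, hxK, squeeze_zero (fun _ => norm_nonneg _)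
    (g := fun n : ℕ => 1 / ((n : ℝ) + 1) * (R + R)) (fun n => ?_) ?_⟩
  · rw [hx, norm_smul, Real.norm_of_nonneg Nat.one_div_pos_of_nat.le]
    gcongr
    exact (norm_sub_le _ _).trans (add_le_add (hR _ (hT (hxK n))) (hR _ hp))
  · simpa using tendsto_one_div_add_atTop_nhds_zero_nat (𝕜 := ℝ) |>.mul_const (R + R)

theorem exists_subseq_tendsto_apply {x : ℕ → Ell1} {R : ℝ} (hx : ∀ n, ‖x n‖ ≤ R) :
    ∃ (y : Ell1) (s : ℕ → ℕ), StrictMono s ∧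
      ∀ i, Tendsto (fun n => x (s n) i) atTop (𝓝 (y i)) := by
  have hc : IsCompact (Set.univ.pi fun _ : ℕ => Set.Icc (-R) R) :=
    isCompact_univ_pi fun _ => isCompact_Icc
  obtain ⟨a, -, s, hs, ha⟩ := hc.tendsto_subseq (x := fun n => (x n : ℕ → ℝ)) fun n i _ =>
    abs_le.1 ((lp.norm_apply_le_norm one_ne_zero (x n) i).trans (hx n))
  have hb : Bornology.IsBounded (Set.range fun n => x (s n)) :=
    isBounded_iff_forall_norm_le.2 ⟨R, Set.forall_mem_range.2 fun n => hx (s n)⟩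
  exact ⟨⟨a, lp.memℓp_of_tendsto hb ha⟩, s, hs, fun i => tendsto_pi_nhds.1 ha i⟩

theorem tendsto_norm_sub_sub_norm {u : ℕ → Ell1} (hu : ∀ i, Tendsto (fun n => u n i) atTop (𝓝 0))
    (v : Ell1) : Tendsto (fun n => ‖u n - v‖ - ‖u n‖) atTop (𝓝 ‖v‖) := by
  have htsum : ∀ n, ‖u n - v‖ - ‖u n‖ = ∑' i, (|u n i - v i| - |u n i|) := fun n =>
    ((hasSum_abs (u n - v)).sub (hasSum_abs (u n))).tsum_eq.symm
  simp_rw [htsum, ← (hasSum_abs v).tsum_eq]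
  refine tendsto_tsum_of_dominated_convergence (summable_abs v) (fun i => ?_)
    (Eventually.of_forall fun n i => ?_)
  · simpa using ((hu i).sub_const (v i)).abs.sub (hu i).abs
  · simpa using abs_abs_sub_abs_le (u n i - v i) (u n i)

theorem norm_map_sub_le_of_approx_fixedPoint {K : Set Ell1} {T : Ell1 → Ell1}
    (hTn : ∀ x ∈ K, ∀ y ∈ K, ‖T x - T y‖ ≤ ‖x - y‖) {x : ℕ → Ell1} (hxK : ∀ n, x n ∈ K)
    (hxT : Tendsto (fun n => ‖T (x n) - x n‖) atTop (𝓝 0)) {y : Ell1}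
    (hxy : ∀ i, Tendsto (fun n => (x n - y) i) atTop (𝓝 0)) {w : Ell1} (hw : w ∈ K) :
    ‖T w - y‖ ≤ ‖w - y‖ := by
  have hTw := tendsto_norm_sub_sub_norm hxy (T w - y)
  have hw' := (tendsto_norm_sub_sub_norm hxy (w - y)).add hxT
  simp only [sub_sub_sub_cancel_right, add_zero] at hTw hw'
  refine le_of_tendsto_of_tendsto' hTw hw' fun n => ?_
  have htri : ‖x n - T w‖ ≤ ‖x n - T (x n)‖ + ‖T (x n) - T w‖ :=
    norm_sub_le_norm_sub_add_norm_sub _ _ _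
  rw [norm_sub_rev (x n) (T (x n))] at htri
  linarith [hTn _ (hxK n) w hw]

theorem exists_eval_eq (f : StrongDual ℝ (WeakDual ℝ X)) : ∃ z : X, ∀ g, f g = g z := by
  obtain ⟨z, hz⟩ := LinearMap.dualEmbedding_surjective (topDualPairing ℝ X) f
  exact ⟨z, fun g => by rw [← hz]; rfl⟩

theorem mul_norm_le_of_forall_apply_le {z : X} {s u : ℝ} (hs : 0 ≤ s)
    (h : ∀ g : StrongDual ℝ X, ‖g‖ ≤ s → g z ≤ u) : s * ‖z‖ ≤ u := by
  obtain ⟨g, hg, hgz⟩ := exists_dual_vector'' ℝ z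
  simpa [hgz] using h (s • g) (by
    rw [norm_smul, Real.norm_of_nonneg hs]
    exact mul_le_of_le_one_right hs hg)

theorem exists_norm_le_one_forall_le_apply {K : Set (WeakDual ℝ X)} (hK : IsCompact K)
    (hconv : Convex ℝ K) {r s : ℝ} (hr : ∀ g ∈ K, r ≤ ‖WeakDual.toStrongDual g‖) (hs : s < r) :
    ∃ z : X, ‖z‖ ≤ 1 ∧ ∀ g ∈ K, s ≤ g z := by
  rcases lt_or_ge s 0 with hs0 | hs0
  · exact ⟨0, by simp, fun g _ => by simpa using hs0.le⟩
  have : LocallyConvexSpace ℝ (WeakDual ℝ X) := (WeakDual.withSeminorms ℝ X).toLocallyConvexSpace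
  obtain ⟨f, u, v, hu, huv, hv⟩ := geometric_hahn_banach_compact_closed
    ((convex_closedBall _ _).linear_preimage
      (WeakDual.toStrongDual : WeakDual ℝ X ≃ₗ[ℝ] StrongDual ℝ X).toLinearMap)
    (WeakDual.isCompact_closedBall 0 s) hconv hK.isClosed
    (Set.disjoint_left.2 fun g hg hgK =>
      (hs.trans_le (hr g hgK)).not_ge (mem_closedBall_zero_iff.1 hg))
  obtain ⟨z, hz⟩ := exists_eval_eq f
  have hball : ∀ g : StrongDual ℝ X, ‖g‖ ≤ s → g z < u := fun g hg =>
    hz (StrongDual.toWeakDual g) ▸ hu _ (mem_closedBall_zero_iff.2 hg)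
  have hu0 : 0 < u := by simpa using hball 0 (by simpa using hs0)
  have hsz : s * ‖z‖ ≤ u := mul_norm_le_of_forall_apply_le hs0 fun g hg => (hball g hg).le
  refine ⟨‖z‖⁻¹ • z, ?_, fun g hg => ?_⟩
  · rw [norm_smul, norm_inv, norm_norm]
    exact inv_mul_le_one
  · have hgz : u < g z := huv.trans (hz g ▸ hv g hg)
    have hz0 : 0 < ‖z‖ := norm_pos_iff.2 fun h => by
      rw [h, map_zero] at hgz
      exact hu0.not_gt hgz
    rw [map_smul, smul_eq_mul, inv_mul_eq_div, le_div_iff₀ hz0]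
    exact hsz.trans hgz.le

variable (φ : StrongDual ℝ X ≃ₗᵢ[ℝ] Ell1)

theorem continuous_toWeak : Continuous (toWeak φ) :=
  NormedSpace.Dual.toWeakDual_continuous.comp φ.symm.continuous

theorem isClosed_of_isCompact_weakStar {K : Set Ell1} (hK : @IsCompact Ell1 (weakStar φ) K) :
    IsClosed K := by
  rw [← (toWeak φ).injective.preimage_image K]
  exact ((isCompact_weakStar_iff φ).1 hK).isClosed.preimage (continuous_toWeak φ)

theorem isBounded_of_isCompact_weakStar [CompleteSpace X] {K : Set Ell1}
    (hK : @IsCompact Ell1 (weakStar φ) K) : Bornology.IsBounded K := by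
  rw [isCompact_weakStar_iff] at hK
  obtain ⟨R, hR⟩ := banach_steinhaus (g := fun x : K => φ.symm (x : Ell1)) fun z => by
    obtain ⟨R, hR⟩ := (hK.image (WeakDual.eval_continuous z)).isBounded.exists_norm_le
    exact ⟨R, fun x => hR _ ⟨_, ⟨x, x.2, rfl⟩, rfl⟩⟩
  exact isBounded_iff_forall_norm_le.2 ⟨R, fun x hx => by simpa using hR ⟨x, hx⟩⟩

theorem isCompact_toWeak_closedBall (y : Ell1) (r : ℝ) :
    IsCompact (toWeak φ '' Metric.closedBall y r) := by
  have himage : toWeak φ '' Metric.closedBall y r =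
      WeakDual.toStrongDual ⁻¹' Metric.closedBall (φ.symm y) r := by
    rw [← φ.symm.image_closedBall, ← LinearEquiv.image_symm_eq_preimage, Set.image_image]
    rfl
  rw [himage]
  exact WeakDual.isCompact_closedBall _ r

theorem isCompact_weakStar_inter_closedBall {K : Set Ell1}
    (hK : @IsCompact Ell1 (weakStar φ) K) (y : Ell1) (r : ℝ) :
    @IsCompact Ell1 (weakStar φ) (K ∩ Metric.closedBall y r) := by
  rw [isCompact_weakStar_iff] at hK ⊢
  rw [Set.image_inter (toWeak φ).injective]
  exact hK.inter (isCompact_toWeak_closedBall φ y r)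

theorem t2Space_weakStar : @T2Space Ell1 (weakStar φ) :=
  letI := weakStar φ
  (IsEmbedding.mk ⟨rfl⟩ (toWeak φ).injective : IsEmbedding (toWeak φ)).t2Space

variable {φ}

theorem norm_sub_eq_of_minimal {T : Ell1 → Ell1} {K : Set Ell1}
    (hK : Minimal (IsInvariantConvexCompact (weakStar φ) T) K) {y : Ell1}
    (hdist : ∀ w ∈ K, ‖T w - y‖ ≤ ‖w - y‖) {p w : Ell1} (hp : p ∈ K) (hw : w ∈ K) :
    ‖w - y‖ = ‖p - y‖ := by
  have hle : ∀ p ∈ K, ∀ w ∈ K, ‖w - y‖ ≤ ‖p - y‖ := fun p hp w hw => by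
    refine mem_closedBall_iff_norm.1 (hK.le_of_le
      (y := K ∩ Metric.closedBall y ‖p - y‖) ?_ Set.inter_subset_left hw).2
    exact IsInvariantConvexCompact.mk (t := weakStar φ)
      ⟨p, hp, mem_closedBall_iff_norm.2 le_rfl⟩
      (hK.prop.convex.inter (convex_closedBall _ _))
      (isCompact_weakStar_inter_closedBall φ hK.prop.isCompact y _)
      fun q hq => ⟨hK.prop.mapsTo hq.1, mem_closedBall_iff_norm.2
        ((hdist q hq.1).trans (mem_closedBall_iff_norm.1 hq.2))⟩
  exact le_antisymm (hle p hp w hw) (hle w hw p hp)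

theorem exists_norm_le_one_forall_le_dual_sub {K : Set Ell1}
    (hK : @IsCompact Ell1 (weakStar φ) K) (hconv : Convex ℝ K) {y : Ell1} {r s : ℝ}
    (hr : ∀ w ∈ K, r ≤ ‖w - y‖) (hs : s < r) :
    ∃ z : X, ‖z‖ ≤ 1 ∧ ∀ w ∈ K, s ≤ φ.symm (w - y) z := by
  have htranslate : Convex ℝ ((· - toWeak φ y) '' (toWeak φ '' K)) := by
    simpa only [neg_add_eq_sub, LinearEquiv.coe_coe] using
      (hconv.linear_image (toWeak φ).toLinearMap).translate (-toWeak φ y)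
  have hnorm : ∀ g ∈ (· - toWeak φ y) '' (toWeak φ '' K), r ≤ ‖WeakDual.toStrongDual g‖ := by
    rintro _ ⟨_, ⟨w, hw, rfl⟩, rfl⟩
    refine (hr w hw).trans_eq ?_
    rw [← φ.symm.norm_map (w - y), map_sub]
    rfl
  obtain ⟨z, hz, hKz⟩ := exists_norm_le_one_forall_le_apply
    (((isCompact_weakStar_iff φ).1 hK).image (continuous_sub_right _)) htranslate hnorm hs
  refine ⟨z, hz, fun w hw => ?_⟩
  rw [map_sub]
  exact hKz _ ⟨_, ⟨w, hw, rfl⟩, rfl⟩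

theorem isAsymptoticallyNormed_of_norm_sub_eq {K : Set Ell1}
    (hK : @IsCompact Ell1 (weakStar φ) K) (hconv : Convex ℝ K) {y : Ell1} {ρ : ℝ} (hρ : 0 < ρ)
    (hKρ : ∀ w ∈ K, ‖w - y‖ = ρ) {x : ℕ → Ell1} (hx : ∀ m, x m ∈ K) :
    ∃ z : ℕ → X, IsAsymptoticallyNormed φ (fun m => ρ⁻¹ • (x m - y)) z := by
  have hlim : Tendsto (fun j : ℕ => 1 - 1 / ((j : ℝ) + 1)) atTop (𝓝 1) := by
    simpa using tendsto_one_div_add_atTop_nhds_zero_nat (𝕜 := ℝ) |>.const_sub 1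
  have hlt : ∀ j : ℕ, ρ * (1 - 1 / ((j : ℝ) + 1)) < ρ := fun j =>
    mul_lt_of_lt_one_right hρ (sub_lt_self 1 Nat.one_div_pos_of_nat)
  choose z hz hKz using fun j =>
    exists_norm_le_one_forall_le_dual_sub hK hconv (fun w hw => (hKρ w hw).ge) (hlt j)
  have hlower : ∀ (j : ℕ) m, 1 - 1 / ((j : ℝ) + 1) ≤ φ.symm (ρ⁻¹ • (x m - y)) (z j) := fun j m => by
    simpa [inv_mul_eq_div, le_div_iff₀ hρ, mul_comm] using hKz j (x m) (hx m)
  have hnorm : ∀ m, ‖ρ⁻¹ • (x m - y)‖ = 1 := fun m => by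
    rw [norm_smul, hKρ _ (hx m), norm_inv, Real.norm_of_nonneg hρ.le, inv_mul_cancel₀ hρ.ne']
  exact ⟨z, fun m => (hnorm m).le, hz, fun m => tendsto_of_tendsto_of_tendsto_of_le_of_le hlim
    tendsto_const_nhds (fun j => hlower j m)
    fun j => (dual_apply_le_norm φ _ (hz j)).trans_eq (hnorm m),
    _, hlim, fun j => Eventually.of_forall (hlower j)⟩

theorem hasNormOneLimit_of_minimal [CompleteSpace X] {T : Ell1 → Ell1} {K : Set Ell1}
    (hK : Minimal (IsInvariantConvexCompact (weakStar φ) T) K)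
    (hTn : ∀ x ∈ K, ∀ y ∈ K, ‖T x - T y‖ ≤ ‖x - y‖) (hfix : ∀ x ∈ K, T x ≠ x) :
    HasNormOneLimit φ := by
  have hcomp := hK.prop.isCompact
  have hbdd := isBounded_of_isCompact_weakStar φ hcomp
  obtain ⟨x, hxK, hxT⟩ := exists_approx_fixedPoint_seq
    (isClosed_of_isCompact_weakStar φ hcomp).isComplete hK.prop.nonempty hK.prop.convex hbdd
    hK.prop.mapsTo hTn
  obtain ⟨R, hR⟩ := hbdd.exists_norm_le
  obtain ⟨y, s, hs, hxy⟩ := exists_subseq_tendsto_apply fun n => hR _ (hxK n)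
  have hxy0 : ∀ i, Tendsto (fun n => (x (s n) - y) i) atTop (𝓝 0) := fun i => by
    simpa using (hxy i).sub_const (y i)
  have hdist : ∀ w ∈ K, ‖T w - y‖ ≤ ‖w - y‖ := fun w hw =>
    norm_map_sub_le_of_approx_fixedPoint hTn (fun n => hxK (s n)) (hxT.comp hs.tendsto_atTop)
      hxy0 hw
  obtain ⟨p, hp⟩ := hK.prop.nonempty
  have hconst : ∀ w ∈ K, ‖w - y‖ = ‖p - y‖ := fun w hw => norm_sub_eq_of_minimal hK hdist hp hw
  have hρ : 0 < ‖p - y‖ := by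
    refine norm_pos_iff.2 fun h0 => hfix p hp ?_
    have hTp := hconst _ (hK.prop.mapsTo hp)
    rw [h0, norm_zero, norm_eq_zero] at hTp
    exact sub_left_inj.1 (hTp.trans h0.symm)
  obtain ⟨z, hz⟩ := isAsymptoticallyNormed_of_norm_sub_eq hcomp hK.prop.convex hρ hconst
    fun m => hxK (s m)
  exact hz.hasNormOneLimit fun i => by
    have h := (hxy0 i).const_mul ‖p - y‖⁻¹
    rwa [mul_zero] at h

theorem hasNormOneLimit_of_not_hasFPP_nonexpansive [CompleteSpace X]
    (h : ¬ HasFPP φ Nonexpansive) : HasNormOneLimit φ := by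
  have := t2Space_weakStar φ
  unfold HasFPP at h
  push Not at h
  obtain ⟨C, hne, hconv, hcomp, T₀, hT₀, hfix⟩ := h
  let T : Ell1 → Ell1 := Function.extend Subtype.val (fun x => (T₀ x : Ell1)) id
  have hT : ∀ x : C, T x = T₀ x := Subtype.val_injective.extend_apply _ _
  obtain ⟨K, hKC, hK⟩ := IsInvariantConvexCompact.exists_minimal (t := weakStar φ)
    (T := T) (IsInvariantConvexCompact.mk (t := weakStar φ) hne hconv hcomp
      fun x hx => hT ⟨x, hx⟩ ▸ (T₀ ⟨x, hx⟩).2)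
  refine hasNormOneLimit_of_minimal hK (fun x hx y hy => ?_) fun x hx hTx => ?_
  · have hxy := hT₀ ⟨x, hKC hx⟩ ⟨y, hKC hy⟩
    rwa [← hT, ← hT] at hxy
  · exact hfix ⟨x, hKC hx⟩ (Subtype.ext ((hT ⟨x, hKC hx⟩).symm.trans hTx))

/-! ### Isometric copies of `ℓ₁` spanned by disjoint elements -/

section Copies

/-- The sequence with first term `a`, followed by the terms of `f`. -/
def consSeq {α : Type*} (a : α) (f : ℕ → α) : ℕ → α
  | 0 => a
  | n + 1 => f n

/-- The element of `ℓ₁` with first coordinate `a`, followed by the coordinates of `b`. -/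
def cons (a : ℝ) (b : Ell1) : Ell1 :=
  ofSummable (consSeq a b) ((summable_nat_add_iff 1).1 (summable_abs b))

theorem cons_zero (a : ℝ) (b : Ell1) : cons a b 0 = a := rfl

theorem cons_succ (a : ℝ) (b : Ell1) (n : ℕ) : cons a b (n + 1) = b n := rfl

theorem norm_cons (a : ℝ) (b : Ell1) : ‖cons a b‖ = |a| + ‖b‖ := by
  rw [← (hasSum_abs _).tsum_eq, ← (hasSum_abs b).tsum_eq, (summable_abs _).tsum_eq_zero_add]
  simp only [cons_zero, cons_succ]

theorem tsum_cons (a : ℝ) (b : Ell1) : ∑' n, cons a b n = a + ∑' n, b n := by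
  rw [(summable_apply _).tsum_eq_zero_add]
  simp only [cons_zero, cons_succ]

variable {d : ℕ → Ell1}

theorem summable_smul_of_norm_eq_one (hd : ∀ k, ‖d k‖ = 1) (b : Ell1) :
    Summable fun k => b k • d k :=
  Summable.of_norm (by simpa [norm_smul, hd] using summable_abs b)

theorem tsum_smul_apply (hd : ∀ k, ‖d k‖ = 1) (b : Ell1) (i : ℕ) :
    (∑' k, b k • d k) i = ∑' k, b k * d k i :=
  (lp.evalCLM ℝ (fun _ : ℕ => ℝ) (p := 1) i).map_tsum (summable_smul_of_norm_eq_one hd b)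

theorem abs_tsum_eq_tsum_abs_of_subsingleton {a : ℕ → ℝ}
    (ha : Pairwise fun j k => a j = 0 ∨ a k = 0) : |∑' k, a k| = ∑' k, |a k| := by
  by_cases h : ∃ k, a k ≠ 0
  · obtain ⟨k, hk⟩ := h
    have h0 : ∀ j, j ≠ k → a j = 0 := fun j hj => (ha hj).resolve_right hk
    rw [tsum_eq_single k h0, tsum_eq_single k fun j hj => abs_eq_zero.2 (h0 j hj)]
  · push Not at h
    simp only [h, tsum_zero, abs_zero]

theorem norm_tsum_smul_of_disjoint (hd : ∀ k, ‖d k‖ = 1)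
    (hdisj : Pairwise fun j k => ∀ i, d j i = 0 ∨ d k i = 0) (b : Ell1) :
    ‖∑' k, b k • d k‖ = ‖b‖ := by
  have habs : ∀ i, |(∑' k, b k • d k) i| = ∑' k, |b k| * |d k i| := fun i => by
    simp_rw [tsum_smul_apply hd, ← abs_mul]
    exact abs_tsum_eq_tsum_abs_of_subsingleton fun j k hjk =>
      (hdisj hjk i).imp (mul_eq_zero_of_right _) (mul_eq_zero_of_right _)
  have hsum : Summable (Function.uncurry fun k i => |b k| * |d k i|) := by
    refine (summable_prod_of_nonneg fun p =>
      mul_nonneg (abs_nonneg _) (abs_nonneg _)).2 ⟨fun k => ?_, ?_⟩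
    · exact (summable_abs (d k)).mul_left |b k|
    · simpa [tsum_mul_left, (hasSum_abs _).tsum_eq, hd] using summable_abs b
  rw [← (hasSum_abs _).tsum_eq, tsum_congr habs, hsum.tsum_comm, ← (hasSum_abs b).tsum_eq]
  exact tsum_congr fun k => by rw [tsum_mul_left, (hasSum_abs _).tsum_eq, hd, mul_one]

/-- The isometry of `ℓ₁` into itself sending the standard basis to a sequence of elements of norm
one with disjoint supports. -/
def disjointIsometry (d : ℕ → Ell1) (hd : ∀ k, ‖d k‖ = 1)
    (hdisj : Pairwise fun j k => ∀ i, d j i = 0 ∨ d k i = 0) : Ell1 →ₗᵢ[ℝ] Ell1 where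
  toFun b := ∑' k, b k • d k
  map_add' b b' := by
    rw [← (summable_smul_of_norm_eq_one hd b).tsum_add (summable_smul_of_norm_eq_one hd b')]
    exact tsum_congr fun k => by rw [lp.coeFn_add, Pi.add_apply, add_smul]
  map_smul' r b := by
    rw [RingHom.id_apply, ← tsum_const_smul'']
    exact tsum_congr fun k => by rw [lp.coeFn_smul, Pi.smul_apply, smul_assoc]
  norm_map' := norm_tsum_smul_of_disjoint hd hdisj

theorem disjointIsometry_stdBasis (hd : ∀ k, ‖d k‖ = 1)
    (hdisj : Pairwise fun j k => ∀ i, d j i = 0 ∨ d k i = 0) (k : ℕ) :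
    disjointIsometry d hd hdisj (stdBasis k) = d k := by
  change ∑' j, stdBasis k j • d j = d k
  rw [tsum_eq_single k fun j hj => ?_, stdBasis_apply_self, one_smul]
  rw [stdBasis_apply_of_ne hj, zero_smul]

theorem disjointIsometry_cons (hd : ∀ k, ‖d k‖ = 1)
    (hdisj : Pairwise fun j k => ∀ i, d j i = 0 ∨ d k i = 0) (a : ℝ) (b : Ell1) :
    disjointIsometry d hd hdisj (cons a b) = a • d 0 + ∑' k, b k • d (k + 1) :=
  (summable_smul_of_norm_eq_one hd (cons a b)).tsum_eq_zero_add

/-- The nonnegative elements of `ℓ₁` with sum one. -/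
def simplex : Set Ell1 := {b | (∀ i, 0 ≤ b i) ∧ ∑' i, b i = 1}

theorem mem_simplex_of_norm {c : Ell1} (h0 : ∀ i, 0 ≤ c i) (h1 : ‖c‖ = 1) : c ∈ simplex :=
  ⟨h0, by
    rw [← h1, ← (hasSum_abs c).tsum_eq]
    exact tsum_congr fun i => (abs_of_nonneg (h0 i)).symm⟩

/-- An isometric copy of `ℓ₁` in `X*` whose basis converges weak* to the point `A c` of its
simplex. -/
def IsWeakStarCopy (A : Ell1 →ₗᵢ[ℝ] StrongDual ℝ X) (c : Ell1) : Prop :=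
  c ∈ simplex ∧ ∀ z : X, Tendsto (fun k => A (stdBasis k) z) atTop (𝓝 (A c z))

theorem exists_split_along {n : ℕ → ℕ} (hn : Function.Injective n) (e : Ell1) :
    ∃ u : Ell1, (∀ k, u (n k) = 0) ∧ (∀ i ∉ Set.range n, u i = e i) ∧
      HasSum (fun k => e (n k) • stdBasis (n k)) (e - u) := by
  classical
  let u : Ell1 := ofSummable ((Set.range n)ᶜ.indicator e)
    (((summable_abs e).indicator (Set.range n)ᶜ).congr fun i =>
      congrFun (Set.indicator_comp_of_zero abs_zero) i)
  have hu0 : ∀ k, u (n k) = 0 := fun k =>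
    Set.indicator_of_notMem (Set.notMem_compl_iff.2 (Set.mem_range_self k)) e
  have hu : ∀ i ∉ Set.range n, u i = e i := fun i hi => Set.indicator_of_mem hi e
  refine ⟨u, hu0, hu, ?_⟩
  have h := (hn.hasSum_iff fun i hi => ?_).2 (hasSum_smul_stdBasis (e - u))
  · refine h.congr_fun fun k => ?_
    rw [Function.comp_apply, lp.coeFn_sub, Pi.sub_apply, hu0, sub_zero]
  · rw [lp.coeFn_sub, Pi.sub_apply, hu i hi, sub_self, zero_smul]

theorem pairwise_disjoint_consSeq_stdBasis {n : ℕ → ℕ} (hn : Function.Injective n) {u : Ell1}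
    (hu : ∀ k, u (n k) = 0) :
    Pairwise fun j k => ∀ i, consSeq u (fun k => stdBasis (n k)) j i = 0 ∨
      consSeq u (fun k => stdBasis (n k)) k i = 0 := by
  have hu_basis : ∀ k i, u i = 0 ∨ stdBasis (n k) i = 0 := fun k i => by
    rcases eq_or_ne i (n k) with rfl | hi
    · exact Or.inl (hu k)
    · exact Or.inr (stdBasis_apply_of_ne hi)
  rintro (_ | j) (_ | k) hjk i
  · exact absurd rfl hjk
  · exact hu_basis k i
  · exact (hu_basis j i).symm
  · rcases eq_or_ne i (n j) with rfl | hi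
    · exact Or.inr (stdBasis_apply_of_ne fun h => hjk (congrArg Nat.succ (hn h)))
    · exact Or.inl (stdBasis_apply_of_ne hi)

theorem exists_linearIsometry_extending_stdBasis {n : ℕ → ℕ} (hn : Function.Injective n)
    {e : Ell1} (he : ∃ i ∉ Set.range n, e i ≠ 0) (hpos : ∀ k, 0 ≤ e (n k)) :
    ∃ (D : Ell1 →ₗᵢ[ℝ] Ell1) (c : Ell1), D c = e ∧ (∀ k, 0 ≤ c k) ∧
      ∀ k, D (stdBasis (k + 1)) = stdBasis (n k) := by
  obtain ⟨u, hu0, hue, hsum⟩ := exists_split_along hn e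
  have hu : ‖u‖ ≠ 0 := by
    obtain ⟨i, hi, hei⟩ := he
    rw [norm_ne_zero_iff]
    rintro rfl
    exact hei (hue i hi).symm
  have hd : ∀ k, ‖consSeq (‖u‖⁻¹ • u) (fun k => stdBasis (n k)) k‖ = 1 := by
    rintro (_ | k)
    · exact norm_smul_inv_norm (𝕜 := ℝ) (norm_ne_zero_iff.1 hu)
    · exact norm_stdBasis _
  have hdisj := pairwise_disjoint_consSeq_stdBasis hn (u := ‖u‖⁻¹ • u)
    fun k => by rw [lp.coeFn_smul, Pi.smul_apply, hu0, smul_zero]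
  refine ⟨disjointIsometry _ hd hdisj,
    cons ‖u‖ (ofSummable (fun k => e (n k)) ((summable_abs e).comp_injective hn)), ?_, ?_,
    fun k => disjointIsometry_stdBasis hd hdisj (k + 1)⟩
  · have h : ‖u‖ • ‖u‖⁻¹ • u + ∑' k, e (n k) • stdBasis (n k) = e := by
      rw [smul_inv_smul₀ hu, hsum.tsum_eq, add_sub_cancel]
    exact (disjointIsometry_cons hd hdisj _ _).trans h
  · rintro (_ | k)
    · exact norm_nonneg u
    · exact hpos k

theorem exists_isWeakStarCopy {φ : StrongDual ℝ X ≃ₗᵢ[ℝ] Ell1} (h : HasNormOneLimit φ) :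
    ∃ (A : Ell1 →ₗᵢ[ℝ] StrongDual ℝ X) (c : Ell1), IsWeakStarCopy A c := by
  obtain ⟨n, hn, e, he, hlim, hpos⟩ := h
  rw [tendsto_weakStar_iff] at hlim
  obtain ⟨i, hi⟩ : ∃ i, e i ≠ 0 := by
    by_contra! h0
    simp [show e = 0 from lp.ext (funext h0)] at he
  -- Dropping the first terms of the subsequence leaves a nonzero part of `e` off it.
  have hin : i ∉ Set.range fun k => n (k + (i + 1)) := by
    rintro ⟨k, hk⟩
    have hle : k + (i + 1) ≤ n (k + (i + 1)) := hn.id_le _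
    exact (Nat.lt_succ_self i |>.trans_le (Nat.le_add_left _ k) |>.trans_le hle).ne' hk
  obtain ⟨D, c, hDc, hc, hD⟩ := exists_linearIsometry_extending_stdBasis
    (hn.injective.comp (add_left_injective (i + 1))) ⟨i, hin, hi⟩ fun k => hpos _
  refine ⟨φ.symm.toLinearIsometry.comp D, c,
    mem_simplex_of_norm hc (by rw [← D.norm_map, hDc, he]), fun z => ?_⟩
  rw [← tendsto_add_atTop_iff_nat 1]
  refine (?_ : Tendsto (fun k => φ.symm (D (stdBasis (k + 1))) z) atTop (𝓝 (φ.symm (D c) z)))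
  simp only [hDc, hD]
  exact (hlim z).comp (tendsto_add_atTop_nat (i + 1))

/-! ### Weak* compactness of the simplex of a weak* copy -/

theorem convex_simplex : Convex ℝ simplex := by
  rintro x ⟨hx0, hx1⟩ y ⟨hy0, hy1⟩ a b ha hb hab
  refine ⟨fun i => add_nonneg (mul_nonneg ha (hx0 i)) (mul_nonneg hb (hy0 i)), ?_⟩
  have h := ((summable_apply x).hasSum.mul_left a).add ((summable_apply y).hasSum.mul_left b)
  rw [hx1, hy1, mul_one, mul_one, hab] at h
  exact h.tsum_eq

/-- The nonnegative sequences with sum at most one. -/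
def subsimplex : Set (ℕ → ℝ) := {t | (∀ i, 0 ≤ t i) ∧ ∀ N, ∑ i ∈ Finset.range N, t i ≤ 1}

theorem summable_of_mem_subsimplex {t : ℕ → ℝ} (ht : t ∈ subsimplex) : Summable t :=
  summable_of_sum_range_le ht.1 ht.2

theorem tsum_le_one_of_mem_subsimplex {t : ℕ → ℝ} (ht : t ∈ subsimplex) : ∑' i, t i ≤ 1 :=
  Real.tsum_le_of_sum_range_le ht.1 ht.2

theorem isCompact_subsimplex : IsCompact subsimplex := by
  refine (isCompact_univ_pi fun _ : ℕ => isCompact_Icc (a := (0 : ℝ)) (b := 1)).of_isClosed_subset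
    ?_ fun t ht i _ => ⟨ht.1 i, ?_⟩
  · have : subsimplex = (⋂ i, {t | 0 ≤ t i}) ∩ ⋂ N, {t | ∑ i ∈ Finset.range N, t i ≤ 1} := by
      ext t; simp [subsimplex]
    rw [this]
    refine (isClosed_iInter fun i => isClosed_le continuous_const (continuous_apply i)).inter
      (isClosed_iInter fun N => isClosed_le ?_ continuous_const)
    exact continuous_finsetSum _ fun i _ => continuous_apply i
  · exact (Finset.single_le_sum (f := t) (fun j _ => ht.1 j) (Finset.self_mem_range_succ i)).trans
      (ht.2 (i + 1))

theorem norm_mul_le_of_mem_subsimplex {t : ℕ → ℝ} (ht : t ∈ subsimplex) {r M : ℝ} (hr : ‖r‖ ≤ M)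
    (k : ℕ) : ‖t k * r‖ ≤ t k * M := by
  rw [norm_mul, Real.norm_of_nonneg (ht.1 k)]
  exact mul_le_mul_of_nonneg_left hr (ht.1 k)

theorem norm_tsum_tail_le_of_mem_subsimplex {t : ℕ → ℝ} (ht : t ∈ subsimplex) {b : ℕ → ℝ} {ε : ℝ}
    {N : ℕ} (hb : ∀ k ≥ N, ‖b k‖ ≤ ε) : ‖∑' k, t (k + N) * b (k + N)‖ ≤ ε := by
  have hts := summable_of_mem_subsimplex ht
  have htail : ∑' k, t (k + N) ≤ 1 :=
    (le_add_of_nonneg_left (Finset.sum_nonneg fun k _ => ht.1 k)).trans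
      ((hts.sum_add_tsum_nat_add N).trans_le (tsum_le_one_of_mem_subsimplex ht))
  calc ‖∑' k, t (k + N) * b (k + N)‖ ≤ (∑' k, t (k + N)) * ε :=
        tsum_of_norm_bounded (((summable_nat_add_iff N).2 hts).hasSum.mul_right ε) fun k =>
          norm_mul_le_of_mem_subsimplex ht (hb _ (Nat.le_add_left N k)) _
    _ ≤ ε := mul_le_of_le_one_left ((norm_nonneg _).trans (hb N le_rfl)) htail

theorem continuous_tsum_subsimplex {b : ℕ → ℝ} (hb : Tendsto b atTop (𝓝 0)) :
    Continuous fun t : subsimplex => ∑' k, (t : ℕ → ℝ) k * b k := by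
  obtain ⟨M, hM⟩ := (Metric.isBounded_range_of_tendsto b hb).exists_norm_le
  have hsum : ∀ t : subsimplex, Summable fun k => (t : ℕ → ℝ) k * b k := fun t =>
    Summable.of_norm_bounded ((summable_of_mem_subsimplex t.2).mul_right M) fun k =>
      norm_mul_le_of_mem_subsimplex t.2 (hM _ ⟨k, rfl⟩) k
  have hunif : TendstoUniformly
      (fun N (t : subsimplex) => ∑ k ∈ Finset.range N, (t : ℕ → ℝ) k * b k)
      (fun t => ∑' k, (t : ℕ → ℝ) k * b k) atTop := by
    refine Metric.tendstoUniformly_iff.2 fun ε hε => ?_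
    obtain ⟨N₀, hN₀⟩ := Metric.tendsto_atTop.1 hb (ε / 2) (half_pos hε)
    filter_upwards [eventually_ge_atTop N₀] with N hN t
    rw [dist_eq_norm, ← (hsum t).sum_add_tsum_nat_add N, add_sub_cancel_left]
    refine (norm_tsum_tail_le_of_mem_subsimplex t.2 fun k hk => ?_).trans_lt (half_lt_self hε)
    simpa using (hN₀ k (hN.trans hk)).le
  refine hunif.continuous (Eventually.of_forall fun N => ?_).frequently
  exact continuous_finsetSum _ fun k _ =>
    ((continuous_apply k).comp continuous_subtype_val).mul continuous_const

/-- The point of the simplex obtained from `t` by moving its missing mass to `c`. -/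
def completeWith (c : Ell1) (t : subsimplex) : Ell1 :=
  ofSummable t (summable_of_mem_subsimplex t.2).abs + (1 - ∑' i, (t : ℕ → ℝ) i) • c

theorem range_completeWith {c : Ell1} (hc : c ∈ simplex) :
    Set.range (completeWith c) = simplex := by
  have hG : ∀ t i, completeWith c t i = (t : ℕ → ℝ) i + (1 - ∑' i, (t : ℕ → ℝ) i) * c i :=
    fun t i => rfl
  apply Set.Subset.antisymm
  · rintro _ ⟨t, rfl⟩
    refine ⟨fun i => ?_, ?_⟩
    · rw [hG]
      exact add_nonneg (t.2.1 i) (mul_nonneg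
        (sub_nonneg.2 (tsum_le_one_of_mem_subsimplex t.2)) (hc.1 i))
    · rw [tsum_congr (hG t), (summable_of_mem_subsimplex t.2).tsum_add
        ((summable_apply c).mul_left _), tsum_mul_left, hc.2, mul_one, add_sub_cancel]
  · rintro b ⟨hb0, hb1⟩
    refine ⟨⟨b, hb0, fun N => ?_⟩, lp.ext (funext fun i => ?_)⟩
    · exact ((summable_apply b).sum_le_tsum _ fun i _ => hb0 i).trans_eq hb1
    · change b i + (1 - ∑' i, b i) * c i = b i
      rw [hb1, sub_self, zero_mul, add_zero]

theorem apply_completeWith (A : Ell1 →ₗᵢ[ℝ] StrongDual ℝ X) (c : Ell1) (t : subsimplex) (z : X) :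
    A (completeWith c t) z = A c z + ∑' k, (t : ℕ → ℝ) k * (A (stdBasis k) z - A c z) := by
  let b : Ell1 := ofSummable t (summable_of_mem_subsimplex t.2).abs
  have hb : HasSum (fun k => b k * (A (stdBasis k) z - A c z))
      (A b z - (∑' k, b k) * A c z) := by
    simp only [mul_sub]
    exact (hasSum_mul_apply_stdBasis A b z).sub ((summable_apply b).hasSum.mul_right _)
  have hA : A (completeWith c t) z = A b z + (1 - ∑' k, b k) * A c z := by
    change A (b + (1 - ∑' k, b k) • c) z = _
    simp only [map_add, map_smul, add_apply, smul_apply, smul_eq_mul]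
  refine hA.trans ((?_ : _ = A c z + (A b z - (∑' k, b k) * A c z)).trans
    (congrArg _ hb.tsum_eq.symm))
  ring

theorem isCompact_toWeakDual_simplex {A : Ell1 →ₗᵢ[ℝ] StrongDual ℝ X} {c : Ell1}
    (h : IsWeakStarCopy A c) :
    IsCompact ((fun b => StrongDual.toWeakDual (A b)) '' simplex) := by
  have hcont : Continuous fun t => StrongDual.toWeakDual (A (completeWith c t)) := by
    refine WeakDual.continuous_of_continuous_eval fun z => ?_
    have heq : ∀ t, StrongDual.toWeakDual (A (completeWith c t)) z =
        A c z + ∑' k, (t : ℕ → ℝ) k * (A (stdBasis k) z - A c z) :=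
      fun t => apply_completeWith A c t z
    simp_rw [heq]
    refine continuous_const.add (continuous_tsum_subsimplex ?_)
    simpa using (h.2 z).sub_const (A c z)
  have : CompactSpace subsimplex := isCompact_iff_compactSpace.1 isCompact_subsimplex
  rw [← range_completeWith h.1, ← Set.range_comp]
  exact isCompact_range hcont

end Copies

/-! ### Fixed point free maps of the simplex -/

section FixedPointFree

variable {φ : StrongDual ℝ X ≃ₗᵢ[ℝ] Ell1} {A : Ell1 →ₗᵢ[ℝ] StrongDual ℝ X} {c : Ell1}

theorem not_hasFPP_of_mapsTo_simplex (h : IsWeakStarCopy A c)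
    {P : ∀ C : Set Ell1, (C → C) → Prop} {S : Ell1 → Ell1} (hS : Set.MapsTo S simplex simplex)
    (hfix : ∀ b ∈ simplex, S b ≠ b)
    (hP : ∀ (C : Set Ell1) (T : C → C) (B : C → Ell1), (∀ x, B x ∈ simplex) →
      (∀ x y : C, ‖(x : Ell1) - y‖ = ‖B x - B y‖) →
      (∀ x y : C, ‖(T x : Ell1) - T y‖ = ‖S (B x) - S (B y)‖) → P C T) :
    ¬ HasFPP φ P := by
  intro hF
  let D : Ell1 →ₗᵢ[ℝ] Ell1 := φ.toLinearIsometry.comp A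
  have hcomp : IsCompact (toWeak φ '' (D '' simplex)) := by
    rw [Set.image_image]
    convert isCompact_toWeakDual_simplex h using 3 with b
    exact congrArg StrongDual.toWeakDual (φ.symm_apply_apply (A b))
  choose B hB hBx using fun x : D '' simplex => x.2
  have hnorm : ∀ a b, ‖D a - D b‖ = ‖a - b‖ := fun a b => by rw [← map_sub, D.norm_map]
  obtain ⟨x, hx⟩ := hF (D '' simplex) ⟨_, c, h.1, rfl⟩ (convex_simplex.linear_image D.toLinearMap)
    ((isCompact_weakStar_iff φ).2 hcomp) (fun x => ⟨D (S (B x)), S (B x), hS (hB x), rfl⟩)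
    (hP _ _ B hB (fun x y => by rw [← hnorm (B x), hBx, hBx]) fun x y => hnorm _ _)
  exact hfix (B x) (hB x) (D.injective ((congrArg Subtype.val hx).trans (hBx x).symm))

theorem apply_zero_ne_zero_of_mem_simplex {b : Ell1} (hb : b ∈ simplex)
    (hsucc : ∀ k, b k = 0 → b (k + 1) = 0) : b 0 ≠ 0 := by
  intro h0
  have hb0 : ∀ k, b k = 0 := Nat.rec h0 hsucc
  simpa [hb0] using hb.2

theorem norm_cons_sub (a : ℝ) (b b' : Ell1) : ‖cons a b - cons a b'‖ = ‖b - b'‖ := by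
  have : cons a b - cons a b' = cons 0 (b - b') := by
    refine lp.ext (funext fun i => ?_)
    cases i with
    | zero => exact sub_self a
    | succ n => rfl
  rw [this, norm_cons, abs_zero, zero_add]

theorem mapsTo_cons_zero : Set.MapsTo (cons 0) simplex simplex := by
  rintro b ⟨hb0, hb1⟩
  refine ⟨?_, by rw [tsum_cons, hb1, zero_add]⟩
  rintro (_ | k)
  · exact le_rfl
  · exact hb0 k

theorem not_hasFPP_isometric (h : IsWeakStarCopy A c) : ¬ HasFPP φ Isometric := by
  refine not_hasFPP_of_mapsTo_simplex h mapsTo_cons_zero (fun b hb hfix => ?_) ?_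
  · refine apply_zero_ne_zero_of_mem_simplex hb (fun k hk => ?_) ?_
    · rw [← hfix, cons_succ, hk]
    · rw [← hfix, cons_zero]
  · intro C T B _ hB hT x y
    rw [hT, hB, norm_cons_sub]

/-- The convex combination `∑ₖ 2⁻ᵏ Sᵏ b`, `k ≥ 1`, of the iterates of the right shift `S`, computed
recursively. -/
def averageSeq (b : ℕ → ℝ) : ℕ → ℝ
  | 0 => 0
  | n + 1 => (averageSeq b n + b n) / 2

theorem sum_abs_averageSeq_le (b : Ell1) (N : ℕ) :
    ∑ n ∈ Finset.range N, |averageSeq b n| ≤ ‖b‖ := by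
  induction N with
  | zero => simp
  | succ N ih =>
    have hsucc : ∑ n ∈ Finset.range N, |averageSeq b (n + 1)| ≤
        (∑ n ∈ Finset.range N, |averageSeq b n| + ∑ n ∈ Finset.range N, |b n|) / 2 := by
      rw [← Finset.sum_add_distrib, Finset.sum_div]
      refine Finset.sum_le_sum fun n _ => ?_
      rw [averageSeq, abs_div, abs_two]
      gcongr
      exact abs_add_le _ _
    have hb : ∑ n ∈ Finset.range N, |b n| ≤ ‖b‖ :=
      sum_le_hasSum _ (fun i _ => abs_nonneg _) (hasSum_abs b)
    rw [Finset.sum_range_succ', averageSeq, abs_zero]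
    linarith

/-- `averageSeq` as an operator on `ℓ₁`; it is contractive without fixed points on the simplex. -/
def average (b : Ell1) : Ell1 :=
  ofSummable (averageSeq b) (summable_of_sum_range_le (fun _ => abs_nonneg _)
    (sum_abs_averageSeq_le b))

theorem average_zero (b : Ell1) : average b 0 = 0 := rfl

theorem average_succ (b : Ell1) (n : ℕ) : average b (n + 1) = (average b n + b n) / 2 := rfl

theorem average_eq_cons (b : Ell1) : average b = cons 0 ((2 : ℝ)⁻¹ • (average b + b)) := by
  refine lp.ext (funext fun n => ?_)
  cases n with
  | zero => rfl
  | succ n => exact div_eq_inv_mul _ _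

theorem average_sub (b b' : Ell1) : average (b - b') = average b - average b' := by
  refine lp.ext (funext fun n => ?_)
  induction n with
  | zero => exact (sub_self 0).symm
  | succ n ih =>
    rw [lp.coeFn_sub, Pi.sub_apply] at ih ⊢
    rw [average_succ, average_succ, average_succ, ih, lp.coeFn_sub, Pi.sub_apply]
    ring

theorem tsum_average (b : Ell1) : ∑' n, average b n = ∑' n, b n := by
  have h : ∑' n, average b n = ∑' n, (average b n + b n) / 2 := by
    rw [(summable_apply (average b)).tsum_eq_zero_add, average_zero, zero_add]
    simp only [average_succ]
  rw [tsum_div_const, (summable_apply _).tsum_add (summable_apply b)] at h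
  linarith

theorem mapsTo_average : Set.MapsTo average simplex simplex := by
  rintro b ⟨hb0, hb1⟩
  refine ⟨fun n => ?_, by rw [tsum_average, hb1]⟩
  induction n with
  | zero => exact le_rfl
  | succ n ih => exact div_nonneg (add_nonneg ih (hb0 n)) zero_le_two

section Sign

variable {w d : ℕ → ℝ}

theorem pos_succ_of_mul_nonneg (hw : ∀ n, w (n + 1) = (w n + d n) / 2)
    (hwd : ∀ n, 0 ≤ w n * d n) {n : ℕ} (hn : 0 < w n) : 0 < w (n + 1) := by
  rw [hw]
  exact half_pos (add_pos_of_pos_of_nonneg hn (nonneg_of_mul_nonneg_right (hwd n) hn))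

theorem nonneg_of_mul_nonneg_of_pos (hw : ∀ n, w (n + 1) = (w n + d n) / 2)
    (hwd : ∀ n, 0 ≤ w n * d n) {m : ℕ} (hm : 0 < w m) (n : ℕ) : 0 ≤ d n := by
  have hpos : ∀ n, m ≤ n → 0 < w n := fun n hn =>
    Nat.le_induction hm (fun k _ => pos_succ_of_mul_nonneg hw hwd) n hn
  have hneg : ∀ n, w n < 0 → ∀ k, n ≤ k → w k < 0 := fun n hn k hk =>
    Nat.le_induction hn (fun k _ hk => neg_pos.1 (pos_succ_of_mul_nonneg (w := -w) (d := -d)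
      (fun n => by simp only [Pi.neg_apply, hw]; ring)
      (fun n => by simpa using hwd n) (neg_pos.2 hk))) k hk
  have hw0 : ∀ n, 0 ≤ w n := fun n => not_lt.1 fun hn =>
    (lt_trans (hneg n hn _ (le_max_left n m)) (hpos _ (le_max_right n m))).false
  rcases (hw0 n).eq_or_lt with hn | hn
  · linarith [hw n, hw0 (n + 1)]
  · exact nonneg_of_mul_nonneg_right (hwd n) hn

theorem eq_zero_of_mul_nonneg_of_hasSum_zero (hw : ∀ n, w (n + 1) = (w n + d n) / 2)
    (hwd : ∀ n, 0 ≤ w n * d n) (hd : HasSum d 0) : d = 0 := by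
  by_cases hpos : ∃ m, 0 < w m
  · obtain ⟨m, hm⟩ := hpos
    exact (hasSum_zero_iff_of_nonneg (nonneg_of_mul_nonneg_of_pos hw hwd hm)).1 hd
  by_cases hneg : ∃ m, 0 < (-w) m
  · obtain ⟨m, hm⟩ := hneg
    refine neg_eq_zero.1 ((hasSum_zero_iff_of_nonneg (nonneg_of_mul_nonneg_of_pos (w := -w)
      (fun n => ?_) (fun n => ?_) hm)).1 (neg_zero (G := ℝ) ▸ hd.neg))
    · simp only [Pi.neg_apply, hw]; ring
    · simpa using hwd n
  push Not at hpos hneg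
  have hw0 : ∀ n, w n = 0 := fun n => le_antisymm (hpos n) (neg_nonpos.1 (hneg n))
  funext n
  linarith [hw n, hw0 n, hw0 (n + 1), Pi.zero_apply (M := fun _ : ℕ => ℝ) n]

end Sign

theorem norm_average_lt {d : Ell1} (hd : d ≠ 0) (hd0 : ∑' n, d n = 0) : ‖average d‖ < ‖d‖ := by
  by_contra! hle
  have hnorm : ‖average d‖ = ‖average d + d‖ / 2 := by
    conv_lhs => rw [average_eq_cons, norm_cons, abs_zero, zero_add, norm_smul, norm_inv,
      Real.norm_ofNat, ← div_eq_inv_mul]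
  refine hd (lp.ext (eq_zero_of_mul_nonneg_of_hasSum_zero (average_succ d)
    (mul_apply_nonneg_of_norm_add (by linarith)) ?_))
  exact hd0 ▸ (summable_apply d).hasSum

theorem not_hasFPP_contractive (h : IsWeakStarCopy A c) : ¬ HasFPP φ Contractive := by
  refine not_hasFPP_of_mapsTo_simplex h mapsTo_average (fun b hb hfix => ?_) ?_
  · refine apply_zero_ne_zero_of_mem_simplex hb (fun k hk => ?_) ?_
    · rw [← hfix, average_succ, hfix, hk, add_zero, zero_div]
    · rw [← hfix, average_zero]
  · intro C T B hBs hB hT x y hxy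
    rw [hT, hB, ← average_sub]
    refine norm_average_lt ?_ ?_
    · rw [← norm_pos_iff, ← hB, norm_pos_iff, sub_ne_zero]
      exact Subtype.coe_injective.ne hxy
    · exact ((summable_apply _).tsum_sub (summable_apply _)).trans
        (by rw [(hBs x).2, (hBs y).2, sub_self])

end FixedPointFree

/-! ### Operators with isometric adjoint are quotient maps -/

section Quotient

variable {E F : Type*} [NormedAddCommGroup E] [NormedSpace ℝ E] [NormedAddCommGroup F]
  [NormedSpace ℝ F] {T : E →L[ℝ] F}

theorem le_of_forall_mul_le {a b : ℝ} (h : ∀ r ∈ Set.Ioo (0 : ℝ) 1, r * a ≤ b) : a ≤ b := by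
  have hlim : Tendsto (fun r : ℝ => r * a) (𝓝[<] 1) (𝓝 a) :=
    tendsto_nhdsWithin_of_tendsto_nhds (Continuous.tendsto' (by fun_prop) _ _ (one_mul a))
  exact le_of_tendsto hlim (mem_of_superset (Ioo_mem_nhdsLT zero_lt_one) h)

theorem mul_norm_le_of_forall_norm_le {f : StrongDual ℝ E} {r u : ℝ} (hr : 0 ≤ r)
    (h : ∀ x, ‖x‖ ≤ r → f x ≤ u) : r * ‖f‖ ≤ u := by
  have hu : 0 ≤ u := by simpa using h 0 (by simpa using hr)
  have hf : ‖r • f‖ ≤ u := by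
    refine ContinuousLinearMap.opNorm_le_of_unit_norm hu fun x hx => abs_le.2 ?_
    have hrx : ‖r • x‖ ≤ r := by rw [norm_smul, hx, mul_one, Real.norm_of_nonneg hr]
    have hneg := h (-(r • x)) (by rwa [norm_neg])
    rw [map_neg, map_smul] at hneg
    exact ⟨neg_le.1 hneg, (map_smul f r x).symm.trans_le (h _ hrx)⟩
  rwa [norm_smul, Real.norm_of_nonneg hr] at hf

theorem mem_closure_image_closedBall (hT : ∀ ψ : StrongDual ℝ F, ‖ψ‖ ≤ ‖ψ.comp T‖) (y : F) :
    y ∈ closure (T '' Metric.closedBall 0 ‖y‖) := by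
  by_contra hcl
  obtain ⟨ψ, u, hu, huy⟩ := geometric_hahn_banach_closed_point
    ((convex_closedBall (0 : E) ‖y‖).linear_image T.toLinearMap).closure isClosed_closure hcl
  refine huy.not_ge ?_
  calc ψ y ≤ ‖ψ‖ * ‖y‖ := (le_abs_self _).trans (ψ.le_opNorm y)
    _ ≤ ‖y‖ * ‖ψ.comp T‖ := by rw [mul_comm]; gcongr; exact hT ψ
    _ ≤ u := mul_norm_le_of_forall_norm_le (norm_nonneg y) fun x hx =>
        (hu _ (subset_closure ⟨x, mem_closedBall_zero_iff.2 hx, rfl⟩)).le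

theorem exists_approx_preimage (hT : ∀ ψ : StrongDual ℝ F, ‖ψ‖ ≤ ‖ψ.comp T‖) {δ : ℝ} (hδ : 0 < δ)
    (y : F) : ∃ x, ‖x‖ ≤ ‖y‖ ∧ ‖y - T x‖ ≤ δ * ‖y‖ := by
  rcases eq_or_ne y 0 with rfl | hy
  · exact ⟨0, by simp, by simp⟩
  obtain ⟨_, ⟨x, hx, rfl⟩, hxy⟩ := Metric.mem_closure_iff.1 (mem_closure_image_closedBall hT y)
    (δ * ‖y‖) (mul_pos hδ (norm_pos_iff.2 hy))
  exact ⟨x, mem_closedBall_zero_iff.1 hx, (dist_eq_norm y (T x) ▸ hxy).le⟩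

/-- The approximate preimages of the successive errors are summed to a preimage. -/
theorem exists_preimage_of_approx [CompleteSpace E] {g : F → E} {δ : ℝ} (hδ : 0 ≤ δ) (hδ1 : δ < 1)
    (hg : ∀ y, ‖g y‖ ≤ ‖y‖) (hTg : ∀ y, ‖y - T (g y)‖ ≤ δ * ‖y‖) (y : F) :
    ∃ x, T x = y ∧ ‖x‖ ≤ ‖y‖ * (1 - δ)⁻¹ := by
  let err : F → F := fun y => y - T (g y)
  have herr : ∀ n, ‖err^[n] y‖ ≤ ‖y‖ * δ ^ n := by
    intro n
    induction n with
    | zero => simp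
    | succ n ih =>
      rw [Function.iterate_succ_apply']
      calc ‖err (err^[n] y)‖ ≤ δ * ‖err^[n] y‖ := hTg _
        _ ≤ δ * (‖y‖ * δ ^ n) := mul_le_mul_of_nonneg_left ih hδ
        _ = ‖y‖ * δ ^ (n + 1) := by ring
  have hgeo : HasSum (fun n : ℕ => ‖y‖ * δ ^ n) (‖y‖ * (1 - δ)⁻¹) :=
    (hasSum_geometric_of_lt_one hδ hδ1).mul_left _
  have hbound : ∀ n, ‖g (err^[n] y)‖ ≤ ‖y‖ * δ ^ n := fun n => (hg _).trans (herr n)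
  have hsum : Summable fun n => g (err^[n] y) := Summable.of_norm_bounded hgeo.summable hbound
  refine ⟨∑' n, g (err^[n] y), ?_, tsum_of_norm_bounded hgeo hbound⟩
  have hpart : ∀ N, ∑ n ∈ Finset.range N, T (g (err^[n] y)) = y - err^[N] y := fun N => by
    induction N with
    | zero => simp
    | succ N ih =>
      rw [Finset.sum_range_succ, ih, Function.iterate_succ_apply', sub_add]
  have hzero : Tendsto (fun N => err^[N] y) atTop (𝓝 0) :=
    squeeze_zero_norm herr (by
      simpa using (tendsto_pow_atTop_nhds_zero_of_lt_one hδ hδ1).const_mul ‖y‖)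
  have hlim := (hsum.hasSum.mapL T).tendsto_sum_nat
  simp_rw [hpart] at hlim
  exact tendsto_nhds_unique hlim (by simpa using hzero.const_sub y)

theorem exists_preimage_mul_norm_le [CompleteSpace E]
    (hT : ∀ ψ : StrongDual ℝ F, ‖ψ‖ ≤ ‖ψ.comp T‖) {r : ℝ} (hr : 0 < r) (hr1 : r < 1) (y : F) :
    ∃ x, T x = y ∧ r * ‖x‖ ≤ ‖y‖ := by
  choose g hg hTg using exists_approx_preimage hT (sub_pos.2 hr1)
  obtain ⟨x, hx, hxy⟩ :=
    exists_preimage_of_approx (sub_pos.2 hr1).le (sub_lt_self 1 hr) hg hTg y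
  rw [sub_sub_cancel, ← div_eq_mul_inv, le_div_iff₀' hr] at hxy
  exact ⟨x, hx, hxy⟩

theorem nonempty_quotient_ker_linearIsometryEquiv [CompleteSpace E] (hT1 : ∀ x, ‖T x‖ ≤ ‖x‖)
    (hT : ∀ ψ : StrongDual ℝ F, ‖ψ‖ ≤ ‖ψ.comp T‖) :
    Nonempty ((E ⧸ LinearMap.ker (T : E →ₗ[ℝ] F)) ≃ₗᵢ[ℝ] F) := by
  have hsurj : Function.Surjective (T : E →ₗ[ℝ] F) := fun y =>
    (exists_preimage_mul_norm_le hT one_half_pos one_half_lt_one y).imp fun _ => And.left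
  refine ⟨⟨(T : E →ₗ[ℝ] F).quotKerEquivOfSurjective hsurj, fun q => le_antisymm ?_ ?_⟩⟩
  · refine le_of_forall_pos_le_add fun ε hε => ?_
    obtain ⟨x, rfl, hx⟩ := Submodule.Quotient.norm_mk_lt q hε
    exact (hT1 x).trans hx.le
  · obtain ⟨x, rfl⟩ := Submodule.Quotient.mk_surjective _ q
    refine le_of_forall_mul_le fun r hr => ?_
    obtain ⟨x', hx', hrx'⟩ := exists_preimage_mul_norm_le hT hr.1 hr.2 (T x)
    have hmk : (LinearMap.ker (T : E →ₗ[ℝ] F)).mkQ x' =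
        (LinearMap.ker (T : E →ₗ[ℝ] F)).mkQ x :=
      (Submodule.Quotient.eq _).2 <| LinearMap.mem_ker.2 <| by
        rw [map_sub, sub_eq_zero]
        exact hx'
    calc r * ‖(LinearMap.ker (T : E →ₗ[ℝ] F)).mkQ x‖ ≤ r * ‖x'‖ := by
          rw [← hmk]
          exact mul_le_mul_of_nonneg_left (Submodule.Quotient.norm_mk_le _ x') hr.1.le
      _ ≤ ‖T x‖ := hrx'

end Quotient

/-! ### Functionals on the space of convergent sequences -/

section SpaceC

/-- The element of `c` given by a convergent sequence. -/
def ofTendsto (a : ℕ → ℝ) {l : ℝ} (h : Tendsto a atTop (𝓝 l)) : spaceC :=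
  ⟨⟨a, memℓp_infty h.norm.bddAbove_range⟩, l, h⟩

theorem limC_ofTendsto (a : ℕ → ℝ) {l : ℝ} (h : Tendsto a atTop (𝓝 l)) :
    limC (ofTendsto a h) = l :=
  tendsto_nhds_unique (tendsto_limC _) h

theorem spaceC_ext {x y : spaceC} (h : ∀ n, (x : EllInf) n = (y : EllInf) n) : x = y :=
  Subtype.ext (lp.ext (funext h))

theorem abs_apply_le_norm (x : spaceC) (n : ℕ) : |(x : EllInf) n| ≤ ‖x‖ :=
  lp.norm_apply_le_norm ENNReal.top_ne_zero (x : EllInf) n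

/-- The coordinate functionals of `c`. -/
def coordC (n : ℕ) : StrongDual ℝ spaceC :=
  LinearMap.mkContinuous
    { toFun x := (x : EllInf) n
      map_add' _ _ := rfl
      map_smul' _ _ := rfl }
    1 fun x => (abs_apply_le_norm x n).trans_eq (one_mul _).symm

theorem norm_coordC_le (n : ℕ) : ‖coordC n‖ ≤ 1 :=
  LinearMap.mkContinuous_norm_le _ zero_le_one _

theorem norm_spaceC_le {x : spaceC} {M : ℝ} (hM : 0 ≤ M) (h : ∀ n, |(x : EllInf) n| ≤ M) :
    ‖x‖ ≤ M :=
  lp.norm_le_of_forall_le hM h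

theorem norm_mul_apply_le (g : Ell1) (x : spaceC) (n : ℕ) :
    ‖g n * (x : EllInf) n‖ ≤ |g n| * ‖x‖ := by
  rw [norm_mul]
  exact mul_le_mul_of_nonneg_left (abs_apply_le_norm x n) (norm_nonneg _)

theorem summable_mul_apply (g : Ell1) (x : spaceC) : Summable fun n => g n * (x : EllInf) n :=
  Summable.of_norm_bounded ((summable_abs g).mul_right ‖x‖) (norm_mul_apply_le g x)

theorem abs_tsum_mul_apply_le (g : Ell1) (x : spaceC) :
    |∑' n, g n * (x : EllInf) n| ≤ ‖g‖ * ‖x‖ :=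
  tsum_of_norm_bounded (f := fun n => g n * (x : EllInf) n) ((hasSum_abs g).mul_right ‖x‖)
    (norm_mul_apply_le g x)

/-- The unit vectors of `c`. -/
def unitC (n : ℕ) : spaceC :=
  ofTendsto (fun k => if k = n then 1 else 0) (l := 0)
    (tendsto_const_nhds.congr' (by
      filter_upwards [eventually_gt_atTop n] with k hk
      rw [if_neg hk.ne']))

/-- The constant sequence `1`. -/
def oneC : spaceC := ofTendsto (fun _ => 1) (l := 1) tendsto_const_nhds

theorem sum_smul_unitC_apply (a : ℕ → ℝ) (N n : ℕ) :
    ((∑ k ∈ Finset.range N, a k • unitC k : spaceC) : EllInf) n = if n < N then a n else 0 := by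
  have hunit : ∀ k, coordC n (unitC k) = if n = k then 1 else 0 := fun k => rfl
  change coordC n (∑ k ∈ Finset.range N, a k • unitC k) = _
  simp [hunit]

theorem sum_abs_apply_unitC_le (ψ : StrongDual ℝ spaceC) (N : ℕ) :
    ∑ n ∈ Finset.range N, |ψ (unitC n)| ≤ ‖ψ‖ := by
  let s : spaceC := ∑ n ∈ Finset.range N, (SignType.sign (ψ (unitC n)) : ℝ) • unitC n
  have hs : ‖s‖ ≤ 1 := norm_spaceC_le zero_le_one fun n => by
    rw [sum_smul_unitC_apply (fun n => SignType.sign (ψ (unitC n)))]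
    rcases lt_trichotomy (ψ (unitC n)) 0 with h | h | h <;> split_ifs <;> simp [h]
  calc ∑ n ∈ Finset.range N, |ψ (unitC n)| = ψ s := by
        simp only [s, map_sum, map_smul, smul_eq_mul, sign_mul_self]
    _ ≤ ‖ψ‖ := (le_abs_self _).trans (ψ.unit_le_opNorm s hs)

theorem tendsto_sum_smul_unitC (x : spaceC) :
    Tendsto (fun N => ∑ n ∈ Finset.range N, ((x : EllInf) n - limC x) • unitC n + limC x • oneC)
      atTop (𝓝 x) := by
  refine Metric.tendsto_atTop.2 fun ε hε => ?_
  obtain ⟨N₀, hN₀⟩ := Metric.tendsto_atTop.1 (tendsto_limC x) (ε / 2) (half_pos hε)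
  refine ⟨N₀, fun N hN => ?_⟩
  rw [dist_comm, dist_eq_norm]
  refine (norm_spaceC_le (half_pos hε).le fun n => ?_).trans_lt (half_lt_self hε)
  have hn : ((x - (∑ n ∈ Finset.range N, ((x : EllInf) n - limC x) • unitC n + limC x • oneC) :
      spaceC) : EllInf) n =
      (x : EllInf) n - ((if n < N then (x : EllInf) n - limC x else 0) + limC x * 1) := by
    rw [← sum_smul_unitC_apply (fun n => (x : EllInf) n - limC x) N n]
    rfl
  rw [hn, mul_one]
  split_ifs with h
  · rw [sub_add_cancel, sub_self, abs_zero]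
    exact (half_pos hε).le
  · rw [zero_add]
    exact (hN₀ n (hN.trans (not_lt.1 h))).le

theorem exists_dual_spaceC_eq (ψ : StrongDual ℝ spaceC) :
    ∃ (r : ℝ) (g : Ell1), ∀ x : spaceC, ψ x = r * limC x + ∑' n, g n * (x : EllInf) n := by
  let g : Ell1 := ofSummable (fun n => ψ (unitC n))
    (summable_of_sum_range_le (fun _ => abs_nonneg _) (sum_abs_apply_unitC_le ψ))
  refine ⟨ψ oneC - ∑' n, g n, g, fun x => ?_⟩
  have hsum : HasSum (fun n => ((x : EllInf) n - limC x) * g n)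
      (∑' n, g n * (x : EllInf) n - limC x * ∑' n, g n) :=
    ((summable_mul_apply g x).hasSum.sub ((summable_apply g).hasSum.mul_left (limC x))).congr_fun
      fun n => by ring
  have hlim := (ψ.continuous.tendsto x).comp (tendsto_sum_smul_unitC x)
  simp only [Function.comp_def, map_add, map_sum, map_smul, smul_eq_mul] at hlim
  rw [tendsto_nhds_unique hlim (hsum.tendsto_sum_nat.add_const (limC x * ψ oneC))]
  ring

end SpaceC

/-! ### Quotients isometric to hyperplanes of `c` -/

-- Otherwise the seminorm of a hyperplane of `c` is found through the ring structure of `ℓ_∞`,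
-- where unification with a metavariable `NormedSpace` instance fails.
local instance : NormedAddCommGroup spaceC := Submodule.normedAddCommGroup _

section Hyperplane

variable {c : Ell1}

theorem mem_W_cons_iff {a : ℝ} (ha : a ≠ 0) {x : spaceC} :
    x ∈ W (cons a (-a • c)) ↔ limC x = ∑' n, c n * (x : EllInf) n := by
  have h : pairing (cons a (-a • c)) x = a * (limC x - ∑' n, c n * (x : EllInf) n) := by
    change a * limC x + ∑' n, (-a * c n) * (x : EllInf) n = _
    simp_rw [mul_assoc, tsum_mul_left]
    ring
  rw [W, LinearMap.mem_ker, h, mul_eq_zero_iff_left ha, sub_eq_zero]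

/-- The element `(1/2, -c/2)` of `ℓ₁`, whose hyperplane `{x ∈ c : lim x = ∑ₙ cₙ xₙ}` is bad when
`c` is a probability vector. -/
def badElt (c : Ell1) : Ell1 := cons (1 / 2) (-(1 / 2 : ℝ) • c)

theorem isBad_badElt (hc : c ∈ simplex) : IsBad (badElt c) := by
  have hcn : ‖c‖ = 1 := by
    rw [← hc.2, ← (hasSum_abs c).tsum_eq]
    exact tsum_congr fun i => abs_of_nonneg (hc.1 i)
  refine ⟨?_, ?_, Set.infinite_univ.mono fun n _ => ?_⟩
  · rw [badElt, norm_cons, norm_smul, hcn]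
    norm_num
  · rw [badElt, cons_zero]
    norm_num
  · change (1 / 2 : ℝ) * (-(1 / 2) * c n) ≤ 0
    linarith [hc.1 n]

theorem exists_dual_W_cons_eq {a : ℝ} (ha : a ≠ 0) (ψ : StrongDual ℝ (W (cons a (-a • c)))) :
    ∃ g : Ell1, ∀ w : W (cons a (-a • c)), ψ w = ∑' n, g n * ((w : spaceC) : EllInf) n := by
  obtain ⟨ψ', hψ', -⟩ := exists_extension_norm_eq _ ψ
  obtain ⟨r, g, hrg⟩ := exists_dual_spaceC_eq ψ'
  refine ⟨r • c + g, fun w => ?_⟩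
  rw [← hψ', hrg, (mem_W_cons_iff ha).1 w.2, ← tsum_mul_left,
    ← ((summable_mul_apply c w).mul_left r).tsum_add (summable_mul_apply g w)]
  exact tsum_congr fun n => by rw [← mul_assoc, ← add_mul]; rfl

variable {A : Ell1 →ₗᵢ[ℝ] StrongDual ℝ X}

theorem IsWeakStarCopy.ofTendsto_mem_W (h : IsWeakStarCopy A c) (z : X) :
    ofTendsto (fun n => A (stdBasis n) z) (h.2 z) ∈ W (badElt c) := by
  rw [badElt, mem_W_cons_iff one_half_pos.ne', limC_ofTendsto]
  exact (hasSum_mul_apply_stdBasis A c z).tsum_eq.symm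

theorem IsWeakStarCopy.norm_ofTendsto_le (h : IsWeakStarCopy A c) (z : X) :
    ‖ofTendsto (fun n => A (stdBasis n) z) (h.2 z)‖ ≤ ‖z‖ :=
  norm_spaceC_le (norm_nonneg z) fun n =>
    ((A (stdBasis n)).le_opNorm z).trans_eq (by rw [A.norm_map, norm_stdBasis, one_mul])

/-- The operator `z ↦ (A eₙ z)ₙ` from `X` to a hyperplane of `c`. -/
def IsWeakStarCopy.toHyperplane (h : IsWeakStarCopy A c) :
    X →L[ℝ] W (badElt c) :=
  LinearMap.mkContinuous
    { toFun z := ⟨_, h.ofTendsto_mem_W z⟩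
      map_add' z z' := Subtype.ext (spaceC_ext fun n => map_add (A (stdBasis n)) z z')
      map_smul' r z := Subtype.ext (spaceC_ext fun n => map_smul (A (stdBasis n)) r z) }
    1 fun z => (h.norm_ofTendsto_le z).trans_eq (one_mul _).symm

theorem IsWeakStarCopy.norm_le_norm_comp_toHyperplane (h : IsWeakStarCopy A c)
    (ψ : StrongDual ℝ (W (badElt c))) :
    ‖ψ‖ ≤ ‖ψ.comp h.toHyperplane‖ := by
  obtain ⟨g, hg⟩ : ∃ g : Ell1, ∀ w : W (badElt c), ψ w = ∑' n, g n * ((w : spaceC) : EllInf) n :=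
    exists_dual_W_cons_eq one_half_pos.ne' ψ
  have hcomp : ψ.comp h.toHyperplane = A g := by
    ext z
    rw [← (hasSum_mul_apply_stdBasis A g z).tsum_eq]
    exact hg _
  rw [hcomp, A.norm_map]
  refine ψ.opNorm_le_bound (norm_nonneg g) fun w => ?_
  rw [hg]
  exact abs_tsum_mul_apply_le g w

theorem exists_quotient_linearIsometryEquiv_isBad [CompleteSpace X] (h : IsWeakStarCopy A c) :
    ∃ Y : Submodule ℝ X, IsClosed (Y : Set X) ∧
      ∃ f : Ell1, IsBad f ∧ Nonempty ((X ⧸ Y) ≃ₗᵢ[ℝ] W f) :=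
  ⟨_, h.toHyperplane.isClosed_ker, _, isBad_badElt h.1,
    nonempty_quotient_ker_linearIsometryEquiv h.norm_ofTendsto_le h.norm_le_norm_comp_toHyperplane⟩

end Hyperplane

/-! ### Hyperplanes of `c` inside quotients -/

section Extension

variable {E F G : Type*} [SeminormedAddCommGroup E] [NormedSpace ℝ E] [SeminormedAddCommGroup F]
  [NormedSpace ℝ F] [NormedAddCommGroup G] [NormedSpace ℝ G]

theorem exists_dual_apply_linearIsometry_eq {V : Submodule ℝ G} (J : V →ₗᵢ[ℝ] F)
    (ψ : StrongDual ℝ G) : ∃ χ : StrongDual ℝ F, ‖χ‖ ≤ ‖ψ‖ ∧ ∀ v : V, χ (J v) = ψ v := by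
  let e : V ≃ₗ[ℝ] LinearMap.range J.toLinearMap := LinearEquiv.ofInjective _ J.injective
  have he (q) : ‖(e.symm q : G)‖ = ‖q‖ := by
    obtain ⟨v, rfl⟩ := e.surjective q
    rw [e.symm_apply_apply]
    exact (J.norm_map v).symm
  obtain ⟨χ, hχ, hχn⟩ := exists_extension_norm_eq (LinearMap.range J.toLinearMap)
    (((ψ.toLinearMap.comp V.subtype).comp e.symm.toLinearMap).mkContinuous ‖ψ‖ fun q =>
      he q ▸ ψ.le_opNorm (e.symm q))
  refine ⟨χ, hχn.trans_le (LinearMap.mkContinuous_norm_le _ (norm_nonneg ψ) _), fun v => ?_⟩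
  exact (hχ (e v)).trans (congrArg (fun u : V => ψ u) (e.symm_apply_apply v))

theorem norm_comp_mkQL_le {Y : Submodule ℝ E} (χ : StrongDual ℝ (E ⧸ Y)) :
    ‖χ.comp Y.mkQL‖ ≤ ‖χ‖ :=
  ContinuousLinearMap.opNorm_le_bound _ (norm_nonneg χ) fun z =>
    (χ.le_opNorm _).trans
      (mul_le_mul_of_nonneg_left (Submodule.Quotient.norm_mk_le Y z) (norm_nonneg χ))

theorem exists_norm_le_one_mk_eq {Y : Submodule ℝ E} {q : E ⧸ Y} (hq : ‖q‖ < 1) :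
    ∃ z : E, ‖z‖ ≤ 1 ∧ Submodule.Quotient.mk z = q := by
  obtain ⟨z, hz, hzq⟩ := Submodule.Quotient.norm_mk_lt q (sub_pos.2 hq)
  exact ⟨z, hzq.le.trans_eq (add_sub_cancel _ _), hz⟩

end Extension

section TruncatedSequences

variable {c : Ell1} {N : ℕ} {v : ℕ → ℝ}

/-- For `a ≠ 0`, the limit of the sequence in the hyperplane `W (cons a (-a • c))` which agrees
with `v` before the index `N` and is constant from there on. -/
def tailValue (c : Ell1) (v : ℕ → ℝ) (N : ℕ) : ℝ :=
  (∑ n ∈ Finset.range N, c n * v n) / (1 - ∑' k, c (k + N))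

theorem tsum_tail_le (c : Ell1) (N : ℕ) : ∑' k, c (k + N) ≤ ∑' k, |c (k + N)| :=
  ((summable_nat_add_iff N).2 (summable_apply c)).tsum_le_tsum (fun _ => le_abs_self _)
    ((summable_nat_add_iff N).2 (summable_abs c))

theorem sum_abs_eq_norm_sub_tail (c : Ell1) (N : ℕ) :
    ∑ n ∈ Finset.range N, |c n| = ‖c‖ - ∑' k, |c (k + N)| := by
  rw [eq_sub_iff_add_eq, (summable_abs c).sum_add_tsum_nat_add N, (hasSum_abs c).tsum_eq]

theorem abs_tailValue_le_one (hc : ‖c‖ = 1) (hN : ∑' k, |c (k + N)| < 1) (hv : ∀ n, |v n| ≤ 1) :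
    |tailValue c v N| ≤ 1 := by
  have htail := tsum_tail_le c N
  have hpos : 0 < 1 - ∑' k, c (k + N) := by linarith
  rw [tailValue, abs_div, abs_of_pos hpos, div_le_one hpos]
  calc |∑ n ∈ Finset.range N, c n * v n| ≤ ∑ n ∈ Finset.range N, |c n| :=
        Finset.abs_sum_le_sum_abs _ _ |>.trans <| Finset.sum_le_sum fun n _ => by
          rw [abs_mul]
          exact mul_le_of_le_one_right (abs_nonneg _) (hv n)
    _ = 1 - ∑' k, |c (k + N)| := by rw [sum_abs_eq_norm_sub_tail, hc]
    _ ≤ 1 - ∑' k, c (k + N) := sub_le_sub_left htail 1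

theorem tsum_mul_truncation (hN : ∑' k, |c (k + N)| < 1)
    (hs : Summable fun n => c n * if n < N then v n else tailValue c v N) :
    ∑' n, c n * (if n < N then v n else tailValue c v N) = tailValue c v N := by
  have htail := tsum_tail_le c N
  have hpos : 0 < 1 - ∑' k, c (k + N) := by linarith
  have hhead : ∑ n ∈ Finset.range N, c n * (if n < N then v n else tailValue c v N) =
      (1 - ∑' k, c (k + N)) * tailValue c v N := by
    rw [tailValue, mul_div_cancel₀ _ hpos.ne']
    exact Finset.sum_congr rfl fun n hn => by rw [if_pos (Finset.mem_range.1 hn)]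
  rw [← hs.sum_add_tsum_nat_add N, hhead]
  simp only [not_lt.2 (Nat.le_add_left N _), if_false, tsum_mul_right]
  ring

theorem exists_mem_W_cons {a : ℝ} (ha : a ≠ 0) (hc : ‖c‖ = 1) (hN : ∑' k, |c (k + N)| < 1)
    (hv : ∀ n, |v n| ≤ 1) :
    ∃ w : W (cons a (-a • c)), ‖w‖ ≤ 1 ∧
      ∀ n, ((w : spaceC) : EllInf) n = if n < N then v n else tailValue c v N := by
  have hlim : Tendsto (fun n => if n < N then v n else tailValue c v N) atTop
      (𝓝 (tailValue c v N)) :=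
    tendsto_const_nhds.congr' (by
      filter_upwards [eventually_ge_atTop N] with n hn
      rw [if_neg hn.not_gt])
  refine ⟨⟨ofTendsto _ hlim, ?_⟩, norm_spaceC_le zero_le_one fun n => ?_, fun n => rfl⟩
  · rw [mem_W_cons_iff ha, limC_ofTendsto]
    exact (tsum_mul_truncation hN (summable_mul_apply c (ofTendsto _ hlim))).symm
  · change |if n < N then v n else tailValue c v N| ≤ 1
    split_ifs
    exacts [hv n, abs_tailValue_le_one hc hN hv]

/-- A sequence of signs of the coordinates of `c`, with the sign `1` at vanishing coordinates. -/
def signSeq (c : Ell1) (n : ℕ) : ℝ := if 0 ≤ c n then 1 else -1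

theorem abs_signSeq_le_one (c : Ell1) (n : ℕ) : |signSeq c n| ≤ 1 := by
  rw [signSeq]
  split_ifs <;> simp

theorem mul_signSeq (c : Ell1) (n : ℕ) : c n * signSeq c n = |c n| := by
  rw [signSeq]
  split_ifs with h
  · rw [mul_one, abs_of_nonneg h]
  · rw [mul_neg_one, abs_of_neg (not_le.1 h)]

theorem tendsto_tailValue_signSeq (hc : ‖c‖ = 1) :
    Tendsto (tailValue c (signSeq c)) atTop (𝓝 1) := by
  have hnum : Tendsto (fun N => ∑ n ∈ Finset.range N, c n * signSeq c n) atTop (𝓝 ‖c‖) := by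
    simpa only [mul_signSeq] using (hasSum_abs c).tendsto_sum_nat
  have hden := (tendsto_sum_nat_add fun n => c n).const_sub 1
  rw [hc] at hnum
  rw [sub_zero] at hden
  have hdiv := hnum.div hden one_ne_zero
  rw [div_one] at hdiv
  exact hdiv

end TruncatedSequences

section Embedding

variable {φ : StrongDual ℝ X ≃ₗᵢ[ℝ] Ell1}

theorem IsBad.exists_eq_cons {f : Ell1} (hf : IsBad f) :
    ∃ (a : ℝ) (c : Ell1), a ≠ 0 ∧ ‖c‖ = 1 ∧ {n | 0 ≤ c n}.Infinite ∧ f = cons a (-a • c) := by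
  obtain ⟨hnorm, hf0, hinf⟩ := hf
  have ha : f 0 ≠ 0 := abs_pos.1 (by rw [hf0]; exact one_half_pos)
  let b : Ell1 := ofSummable (fun n => f (n + 1)) ((summable_nat_add_iff 1).2 (summable_abs f))
  have hfb : f = cons (f 0) b := lp.ext (funext fun i => by cases i <;> rfl)
  have hb : ‖b‖ = 1 / 2 := by
    rw [hfb, norm_cons, hf0] at hnorm
    linarith
  refine ⟨f 0, (-f 0)⁻¹ • b, ha, ?_, hinf.mono fun n hn => ?_, ?_⟩
  · rw [norm_smul, hb, norm_inv, norm_neg, Real.norm_eq_abs, hf0]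
    norm_num
  · have hcoord : (-f 0)⁻¹ * f (n + 1) = -(f 0 * f (n + 1)) / f 0 ^ 2 := by field_simp
    change 0 ≤ (-f 0)⁻¹ * f (n + 1)
    rw [hcoord]
    exact div_nonneg (neg_nonneg.2 hn) (sq_nonneg _)
  · rwa [smul_inv_smul₀ (neg_ne_zero.2 ha)]

variable (φ) in
/-- The elements `x m` of the unit ball of `ℓ₁` act on `X` as the coordinates of `V`: up to a
factor `s < 1`, the unit ball of `V` is realized by values of the `x m` on the unit ball of `X`. -/
structure RealizesCoordinates (V : Submodule ℝ spaceC) (x : ℕ → Ell1) : Prop where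
  norm_le_one : ∀ m, ‖x m‖ ≤ 1
  exists_dual_apply_eq : ∀ w : V, ‖w‖ ≤ 1 → ∀ s ∈ Set.Ioo (0 : ℝ) 1, ∃ z : X, ‖z‖ ≤ 1 ∧
    ∀ m, φ.symm (x m) z = s * ((w : spaceC) : EllInf) m

theorem exists_realizesCoordinates {Y : Submodule ℝ X} {V : Submodule ℝ spaceC}
    (J : V →ₗᵢ[ℝ] (X ⧸ Y)) : ∃ x, RealizesCoordinates φ V x := by
  choose χ hχn hχ using fun m => exists_dual_apply_linearIsometry_eq J (coordC m)
  refine ⟨fun m => φ ((χ m).comp Y.mkQL), fun m => ?_, fun w hw s hs => ?_⟩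
  · rw [φ.norm_map]
    exact (norm_comp_mkQL_le _).trans ((hχn m).trans (norm_coordC_le m))
  · have hsw : ‖J (s • w)‖ < 1 := by
      rw [map_smul, norm_smul, J.norm_map, Real.norm_of_nonneg hs.1.le]
      exact (mul_le_of_le_one_right hs.1.le hw).trans_lt hs.2
    obtain ⟨z, hz, hzw⟩ := exists_norm_le_one_mk_eq hsw
    refine ⟨z, hz, fun m => ?_⟩
    rw [φ.symm_apply_apply]
    exact (congrArg (χ m) hzw).trans (hχ m (s • w))

theorem RealizesCoordinates.add_mul_le_norm {V : Submodule ℝ spaceC} {x : ℕ → Ell1}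
    (h : RealizesCoordinates φ V x) {w : V} (hw : ‖w‖ ≤ 1) (m m' : ℕ) (σ : ℝ) :
    ((w : spaceC) : EllInf) m + σ * ((w : spaceC) : EllInf) m' ≤ ‖x m + σ • x m'‖ := by
  refine le_of_forall_mul_le fun s hs => ?_
  obtain ⟨z, hz, hxz⟩ := h.exists_dual_apply_eq w hw s hs
  calc s * (((w : spaceC) : EllInf) m + σ * ((w : spaceC) : EllInf) m')
      = φ.symm (x m + σ • x m') z := by
        rw [map_add, map_smul, add_apply, smul_apply, hxz,
          hxz, smul_eq_mul]
        ring
    _ ≤ ‖x m + σ • x m'‖ := dual_apply_le_norm φ _ hz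

variable {a : ℝ} {c : Ell1} {x : ℕ → Ell1}

theorem RealizesCoordinates.norm_add_norm_le (h : RealizesCoordinates φ (W (cons a (-a • c))) x)
    (ha : a ≠ 0) (hc : ‖c‖ = 1) {m m' : ℕ} (hm : m ≠ m') {σ : ℝ} (hσ : |σ| = 1) :
    ‖x m‖ + ‖x m'‖ ≤ ‖x m + σ • x m'‖ := by
  obtain ⟨N, hN, hNm, hNm'⟩ : ∃ N, ∑' k, |c (k + N)| < 1 ∧ m < N ∧ m' < N :=
    (((tendsto_sum_nat_add fun n => |c n|).eventually (gt_mem_nhds zero_lt_one)).and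
      ((eventually_gt_atTop m).and (eventually_gt_atTop m'))).exists
  obtain ⟨w, hw, hwv⟩ := exists_mem_W_cons ha hc hN (v := fun n => if n = m then 1 else σ)
    fun n => by split_ifs <;> simp [hσ]
  have hle := h.add_mul_le_norm hw m m' σ
  rw [hwv m, hwv m', if_pos hNm, if_pos hNm', if_pos rfl, if_neg hm.symm, ← abs_mul_abs_self σ,
    hσ] at hle
  linarith [h.norm_le_one m, h.norm_le_one m']

theorem RealizesCoordinates.apply_eq_zero_or
    (h : RealizesCoordinates φ (W (cons a (-a • c))) x) (ha : a ≠ 0) (hc : ‖c‖ = 1) {m m' : ℕ}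
    (hm : m ≠ m') (i : ℕ) : x m i = 0 ∨ x m' i = 0 :=
  apply_eq_zero_or_of_norm_add_of_norm_sub
    (by simpa using h.norm_add_norm_le ha hc hm (σ := 1) (by simp))
    (by simpa [← sub_eq_add_neg] using h.norm_add_norm_le ha hc hm (σ := -1) (by simp)) i

theorem tendsto_zero_of_pairwise_eq_zero_or {y : ℕ → ℝ}
    (h : Pairwise fun m m' => y m = 0 ∨ y m' = 0) : Tendsto y atTop (𝓝 0) := by
  refine tendsto_const_nhds.congr' ?_
  by_cases hy : ∃ k, y k ≠ 0
  · obtain ⟨k, hk⟩ := hy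
    filter_upwards [eventually_gt_atTop k] with m hm
    exact ((h hm.ne').resolve_right hk).symm
  · push Not at hy
    exact Eventually.of_forall fun m => (hy m).symm

theorem RealizesCoordinates.isAsymptoticallyNormed
    (h : RealizesCoordinates φ (W (cons a (-a • c))) x) (ha : a ≠ 0) (hc : ‖c‖ = 1) {n : ℕ → ℕ}
    (hn : StrictMono n) (hcn : ∀ k, 0 ≤ c (n k)) :
    ∃ z, IsAsymptoticallyNormed φ (fun k => x (n k)) z := by
  obtain ⟨N, hN⟩ := eventually_atTop.1
    ((tendsto_sum_nat_add fun n => |c n|).eventually (gt_mem_nhds zero_lt_one))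
  choose w hw hwv using fun j =>
    exists_mem_W_cons ha hc (hN (j + N) (Nat.le_add_left N j)) (abs_signSeq_le_one c)
  obtain ⟨s, -, hs, hs1⟩ := exists_seq_strictMono_tendsto' (zero_lt_one' ℝ)
  choose z hz hxz using fun j => h.exists_dual_apply_eq (w j) (hw j) (s j) (hs j)
  refine ⟨z, fun k => h.norm_le_one _, hz, fun k => ?_,
    fun j => s j * tailValue c (signSeq c) (j + N), ?_, fun j => ?_⟩
  · refine hs1.congr' ?_
    filter_upwards [eventually_gt_atTop (n k)] with j hj
    rw [hxz, hwv, if_pos (Nat.lt_add_right N hj), signSeq, if_pos (hcn k), mul_one]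
  · simpa using hs1.mul ((tendsto_tailValue_signSeq hc).comp (tendsto_add_atTop_nat N))
  · filter_upwards [eventually_ge_atTop (j + N)] with m hm
    rw [hxz, hwv, if_neg (hm.trans hn.le_apply).not_gt]

theorem hasNormOneLimit_of_linearIsometry {Y : Submodule ℝ X} {f : Ell1} (hf : IsBad f)
    (J : W f →ₗᵢ[ℝ] (X ⧸ Y)) : HasNormOneLimit φ := by
  obtain ⟨a, c, ha, hc, hinf, rfl⟩ := hf.exists_eq_cons
  obtain ⟨x, hx⟩ := exists_realizesCoordinates (φ := φ) J
  have hn : StrictMono (Nat.nth fun n => 0 ≤ c n) := Nat.nth_strictMono hinf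
  obtain ⟨z, hz⟩ := hx.isAsymptoticallyNormed ha hc hn (Nat.nth_mem_of_infinite hinf)
  have hx0 : ∀ i, Tendsto (fun m => x m i) atTop (𝓝 0) := fun i =>
    tendsto_zero_of_pairwise_eq_zero_or fun m m' hm => hx.apply_eq_zero_or ha hc hm i
  exact hz.hasNormOneLimit fun i => (hx0 i).comp hn.tendsto_atTop

end Embedding

end WeakStarFPP

end

theorem theorem4p1 {X : Type*} [NormedAddCommGroup X] [NormedSpace ℝ X] [CompleteSpace X]
    (φ : StrongDual ℝ X ≃ₗᵢ[ℝ] WeakStarFPP.Ell1) :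
    List.TFAE [
      ¬ WeakStarFPP.HasFPP φ WeakStarFPP.Nonexpansive,
      ¬ WeakStarFPP.HasFPP φ WeakStarFPP.Isometric,
      ¬ WeakStarFPP.HasFPP φ WeakStarFPP.Contractive,
      ∃ n : ℕ → ℕ, StrictMono n ∧ ∃ e : WeakStarFPP.Ell1, ‖e‖ = 1 ∧
        Tendsto (fun k => WeakStarFPP.stdBasis (n k)) atTop
          (@nhds WeakStarFPP.Ell1 (WeakStarFPP.weakStar φ) e) ∧
        ∀ k, 0 ≤ e (n k),
      ∃ Y : Submodule ℝ X, IsClosed (Y : Set X) ∧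
        ∃ f : WeakStarFPP.Ell1, WeakStarFPP.IsBad f ∧
          Nonempty ((X ⧸ Y) ≃ₗᵢ[ℝ] WeakStarFPP.W f),
      ∃ Y : Submodule ℝ X, IsClosed (Y : Set X) ∧
        ∃ g : WeakStarFPP.Ell1, WeakStarFPP.IsBad g ∧
          Nonempty (WeakStarFPP.W g →ₗᵢ[ℝ] (X ⧸ Y))] := by
  tfae_have 1 → 4 := WeakStarFPP.hasNormOneLimit_of_not_hasFPP_nonexpansive
  tfae_have 4 → 2 := fun h => by
    obtain ⟨A, c, hA⟩ := WeakStarFPP.exists_isWeakStarCopy h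
    exact WeakStarFPP.not_hasFPP_isometric hA
  tfae_have 4 → 3 := fun h => by
    obtain ⟨A, c, hA⟩ := WeakStarFPP.exists_isWeakStarCopy h
    exact WeakStarFPP.not_hasFPP_contractive hA
  tfae_have 2 → 1 := fun h hF => h fun C hne hconv hcomp T hT =>
    hF C hne hconv hcomp T fun x y => (hT x y).le
  tfae_have 3 → 1 := fun h hF => h fun C hne hconv hcomp T hT =>
    hF C hne hconv hcomp T fun x y => by
      rcases eq_or_ne x y with rfl | hxy
      · simp
      · exact (hT x y hxy).le
  tfae_have 4 → 5 := fun h => by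
    obtain ⟨A, c, hA⟩ := WeakStarFPP.exists_isWeakStarCopy h
    exact WeakStarFPP.exists_quotient_linearIsometryEquiv_isBad hA
  tfae_have 5 → 6 := fun ⟨Y, hY, f, hf, ⟨e⟩⟩ => ⟨Y, hY, f, hf, ⟨e.symm.toLinearIsometry⟩⟩
  tfae_have 6 → 4 := fun ⟨_, _, _, hg, ⟨J⟩⟩ => WeakStarFPP.hasNormOneLimit_of_linearIsometry hg J
  tfae_finish
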